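/- Let $J\ge 1$ be an integer and let $B_1\ge 1$. There are constants $C=C(J,B_1)>0$ and $c=c(J,B_1)>0$ such that the following holds. Let $N$ be a non-negative integer, $\delta>0$, $B_2\ge 1$, $B_3\in\mathbb{R}$, $M\ge 1$, and let $T(x)$ be a complex self-adjoint $N\times N$ matrix depending on $x\in[-\delta,\delta]^J$. Write $\|\cdot\|$ for the $\ell^2$ operator norm, with the convention $\|A^{-1}\|=\infty$ if $A$ is not invertible, and $\mathrm{mes}$ for Lebesgue measure. Assume: (i) $T$ is real analytic on $[-\delta,\delta]^J$ and has a holomorphic extension to (a neighbourhood of) $\mathcal{D}=\{z\in\mathbb{C}^J:\ |\Re z_i|\le\delta,\ |\Im z_i|\le\delta \text{ for } 1\le i\le J\}$ with $\sup_{z\in\mathcal{D}}\|T(z)\|\le B_1$. (ii) For every $x\in[-\delta,\delta]^J$ there is a set $V\subset\{1,\dots,N\}$ with $|V|\le M$ such that the matrix obtained from $T(x)$ by deleting the rows and columns with index in $V$ is invertible, with inverse of norm at most $B_2$ (an empty matrix counts as invertible, with inverse of norm $0$). (iii) $\mathrm{mes}\{x\in[-\delta,\delta]^J:\ \|T^{-1}(x)\|\ge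 B_3\}\le 10^{-3J}J^{-J}\delta^J(1+B_1)^{-J}(1+B_2)^{-J}$. Then for every $\epsilon$ with $0<\epsilon\le(1+B_1+B_2)^{-10M}$, $$\mathrm{mes}\left\{x\in\left[-\tfrac{\delta}{2},\tfrac{\delta}{2}\right]^J:\ \|T^{-1}(x)\|\ge\epsilon^{-1}\right\}\le C\,\delta^J\exp\left(-c\left(\frac{\log\epsilon^{-1}}{M\log(B_2+B_3)}\right)^{1/J}\right).$$ -/

import Mathlib

open scoped Matrix.Norms.L2Operator

/-- The closed real cube `[-r, r]^J`. -/
def realCube (J : ℕ) (r : ℝ) : Set (Fin J → ℝ) :=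
  {x | ∀ i, |x i| ≤ r}

/-- The closed complex box of all `z ∈ ℂ^J` with `|Re z_i| ≤ r` and `|Im z_i| ≤ r` for all `i`. -/
def complexBox (J : ℕ) (r : ℝ) : Set (Fin J → ℂ) :=
  {z | ∀ i, |(z i).re| ≤ r ∧ |(z i).im| ≤ r}

open Classical in
/-- The quantity `‖A⁻¹‖ ∈ [0, ∞]` for the `ℓ²` operator norm, with the convention
`‖A⁻¹‖ = ∞` when `A` is not invertible. -/
noncomputable def invNorm {n : Type*} [Fintype n] [DecidableEq n] (A : Matrix n n ℂ) : ENNReal :=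
  if IsUnit A then ENNReal.ofReal ‖A⁻¹‖ else ⊤

/-- The compression `R_{Vᶜ} A R_{Vᶜ}` of `A` to the coordinates outside `V`, as an operator on
`ℓ²(Vᶜ)`: the rows and columns with index in `V` are deleted. -/
def compressOff {N : ℕ} (A : Matrix (Fin N) (Fin N) ℂ) (V : Finset (Fin N)) :
    Matrix {i : Fin N // i ∉ V} {i : Fin N // i ∉ V} ℂ :=
  A.submatrix Subtype.val Subtype.val

/-- `T` extends from `[-δ, δ]^J` to a function holomorphic on (a neighbourhood of) the closed
complex box of size `δ`, bounded there by `B` in `ℓ²` operator norm. -/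
def HasBoundedHolomorphicExtension {J N : ℕ}
    (T : (Fin J → ℝ) → Matrix (Fin N) (Fin N) ℂ) (δ B : ℝ) : Prop :=
  ∃ F : (Fin J → ℂ) → Matrix (Fin N) (Fin N) ℂ,
    AnalyticOnNhd ℂ F (complexBox J δ) ∧
    (∀ x ∈ realCube J δ, F (fun i => (x i : ℂ)) = T x) ∧
    ∀ z ∈ complexBox J δ, ‖F z‖ ≤ B

/-! The problem reduces to one scalar holomorphic function. Cover the half cube by small sup-norm
balls of radius `r` comparable to `δ / (B₁ * B₂)`. At each centre some compression off a set `V` of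
at most `M` coordinates is invertible, and a Schwarz estimate for the bounded extension keeps it
invertible, with inverse at most `2 * B₂`, on a complex neighbourhood. The determinant of the Schur
complement onto `V` is holomorphic there. With `Λ = B₂ + B₃` and `K` a constant times `M * log Λ`,
it is at most `exp K` everywhere. Where the inverse of `T` is at least `ε⁻¹`, self-adjointness makes
it at most `ε * exp (2 * K)`. Hypothesis (iii) puts in every small ball a point `x₁` with inverse
below `B₃`, and there the determinant is at least `exp (-K)` (`norm_det_schurCompl_le`,
`norm_det_schurCompl_le_of_le_invNorm`, `rpow_neg_le_norm_det_schurCompl`).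

On each ray from `x₁` the one-variable estimate `volume_norm_le_exp_neg_le` bounds the bad set. If
that set were large, it would contain well-separated nodes; the interpolant of the tiny values there
is tiny on a whole disc, while its difference from the function has too many zeros for the value at
the origin to be as large as assumed. Integrating over rays in polar coordinates
(`volume_le_of_radial_slices`) and summing over the cover gives decay `exp (-c * X)`, where `X = log
ε⁻¹ / (M * log Λ)`. This is stronger than the required power `X ^ (1 / J)`, to which it is weakened
at the end. -/

/-! ### One-variable Cartan estimate. -/

/-- A set of large outer measure contains many points with consecutive gaps at least `d`. -/
lemma exists_separated_points {d : ℝ} (hd : 0 ≤ d) (n : ℕ) (E : Set ℝ) (hE : BddBelow E)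
    (hvol : ENNReal.ofReal (n * d) < MeasureTheory.volume E) :
    ∃ x : ℕ → ℝ, (∀ i ≤ n, x i ∈ E) ∧ ∀ i < n, x i + d ≤ x (i + 1) := by
  induction n generalizing E with
  | zero =>
    have hne : E.Nonempty := by
      by_contra h
      simp [Set.not_nonempty_iff_eq_empty.1 h] at hvol
    obtain ⟨a, ha⟩ := hne
    exact ⟨fun _ => a, fun _ _ => ha, fun i hi => absurd hi (Nat.not_lt_zero i)⟩
  | succ k ih =>
    obtain ⟨r, -, hr1, hr2⟩ := ENNReal.lt_iff_exists_real_btwn.1 hvol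
    have hr : ((k + 1 : ℕ) : ℝ) * d < r := (ENNReal.ofReal_lt_ofReal_iff_of_nonneg (by positivity)).1 hr1
    have hne : E.Nonempty := by
      by_contra h
      simp [Set.not_nonempty_iff_eq_empty.1 h] at hr2
    -- Greedy choice: `a` exceeds the infimum by less than the slack `r - (k + 1) * d`, so
    -- discarding everything below `a + d` leaves measure above `k * d`.
    obtain ⟨a, ha, har⟩ := exists_lt_of_csInf_lt hne
      (lt_add_of_pos_right (sInf E) (sub_pos.2 hr))
    have key : ENNReal.ofReal (k * d) < MeasureTheory.volume (E ∩ Set.Ici (a + d)) := by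
      by_contra hcon
      push Not at hcon
      refine absurd hr2 (not_lt.2 ?_)
      have hsub : E ⊆ (E ∩ Set.Ici (a + d)) ∪ Set.Ico (sInf E) (a + d) := by
        intro y hy
        by_cases h : a + d ≤ y
        · exact Or.inl ⟨hy, h⟩
        · exact Or.inr ⟨csInf_le hE hy, not_le.1 h⟩
      calc MeasureTheory.volume E
          ≤ MeasureTheory.volume (E ∩ Set.Ici (a + d))
            + MeasureTheory.volume (Set.Ico (sInf E) (a + d)) :=
            (MeasureTheory.measure_mono hsub).trans (MeasureTheory.measure_union_le _ _)
        _ ≤ ENNReal.ofReal (k * d) + ENNReal.ofReal (a + d - sInf E) := by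
            gcongr
            rw [Real.volume_Ico]
        _ = ENNReal.ofReal (k * d + (a + d - sInf E)) :=
            (ENNReal.ofReal_add (by positivity) (by linarith [csInf_le hE ha])).symm
        _ ≤ ENNReal.ofReal r := by
            apply ENNReal.ofReal_le_ofReal
            push_cast at har
            linarith
    obtain ⟨x, hx1, hx2⟩ := ih (E ∩ Set.Ici (a + d)) (hE.mono Set.inter_subset_left) key
    refine ⟨fun i => Nat.casesOn i a x, ?_, ?_⟩
    · rintro (_ | i) hi
      · exact ha
      · exact (hx1 i (by omega)).1
    · rintro (_ | i) hi
      · exact (hx1 0 (by omega)).2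
      · exact hx2 i (by omega)

lemma mul_abs_sub_le_of_gaps {d : ℝ} {n : ℕ} {x : ℕ → ℝ}
    (hx : ∀ i < n, x i + d ≤ x (i + 1)) {i j : ℕ} (hi : i ≤ n) (hj : j ≤ n) :
    d * |(i : ℝ) - j| ≤ |x i - x j| := by
  have main : ∀ (i k : ℕ), i + k ≤ n → x i + d * k ≤ x (i + k) := by
    intro i k
    induction k with
    | zero => simp
    | succ k ih =>
      intro h
      have h1 := ih (by omega)
      have h2 := hx (i + k) (by omega)
      rw [← add_assoc]
      push_cast
      linarith
  rcases le_total i j with h | h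
  · obtain ⟨k, rfl⟩ := Nat.exists_eq_add_of_le h
    have := main i k hj
    rw [abs_sub_comm (x i), abs_sub_comm (i : ℝ)]
    push_cast
    rw [add_sub_cancel_left, abs_of_nonneg (Nat.cast_nonneg k)]
    exact (by linarith : d * k ≤ x (i + k) - x i).trans (le_abs_self _)
  · obtain ⟨k, rfl⟩ := Nat.exists_eq_add_of_le h
    have := main j k hi
    push_cast
    rw [add_sub_cancel_left, abs_of_nonneg (Nat.cast_nonneg k)]
    exact (by linarith : d * k ≤ x (j + k) - x j).trans (le_abs_self _)

/-- Comparing Lagrange denominators with equally spaced nodes produces these factorials; they become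
binomial coefficients, whose sum is only `2 ^ n`. -/
lemma prod_erase_abs_sub_eq {n i : ℕ} (hi : i ≤ n) :
    ∏ j ∈ (Finset.range (n + 1)).erase i, |(i : ℝ) - j| = i.factorial * (n - i).factorial := by
  obtain ⟨k, rfl⟩ := Nat.exists_eq_add_of_le hi
  have h1 : ∏ j ∈ (Finset.range (i + k + 1)).erase i, |(i : ℝ) - j|
      = ∏ j ∈ (Finset.range (i + k + 1)), if j = i then 1 else |(i : ℝ) - j| := by
    rw [← Finset.mul_prod_erase (Finset.range (i + k + 1)) _
      (Finset.mem_range.2 (by omega : i < i + k + 1))]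
    rw [if_pos rfl, one_mul]
    exact Finset.prod_congr rfl fun j hj => (if_neg (Finset.ne_of_mem_erase hj)).symm
  rw [h1, show i + k + 1 = i + (1 + k) by ring, Finset.prod_range_add, Finset.prod_range_add,
    show i + k - i = k by omega]
  congr 1
  · rw [← Finset.prod_range_reflect, ← Finset.prod_range_add_one_eq_factorial]
    push_cast
    refine Finset.prod_congr rfl fun j hj => ?_
    have hj := Finset.mem_range.1 hj
    rw [if_neg (by omega), Nat.cast_sub (by omega), Nat.cast_sub (by omega)]
    rw [show (i : ℝ) - (i - (1 : ℕ) - j) = j + 1 by push_cast; ring]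
    exact abs_of_nonneg (by positivity)
  · rw [← Finset.prod_range_add_one_eq_factorial]
    push_cast
    simp only [Finset.range_one, Finset.prod_singleton, add_zero, if_true, one_mul]
    refine Finset.prod_congr rfl fun j hj => ?_
    rw [if_neg (by omega), show (i : ℝ) - (i + (1 + j)) = -(j + 1) by ring, abs_neg]
    exact abs_of_nonneg (by positivity)

/-- A holomorphic function on the disc of radius `4` with many zeros in the unit disc is small
at the origin. -/
lemma norm_apply_zero_le_of_zeros (s : Finset ℂ) (hs : ∀ a ∈ s, ‖a‖ ≤ 1) {h : ℂ → ℂ} {B : ℝ}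
    (hd : DifferentiableOn ℂ h (Metric.ball 0 4)) (hB : ∀ z ∈ Metric.ball (0 : ℂ) 4, ‖h z‖ ≤ B)
    (hz : ∀ a ∈ s, h a = 0) : ‖h 0‖ ≤ B / 3 ^ s.card := by
  induction s using Finset.induction_on generalizing h B with
  | empty => simpa using hB 0 (by simp)
  | insert a s ha ih =>
    have ha1 : ‖a‖ ≤ 1 := hs a (Finset.mem_insert_self a s)
    have hha : h a = 0 := hz a (Finset.mem_insert_self a s)
    have ha4 : Metric.ball (0 : ℂ) 4 ∈ nhds a :=
      Metric.isOpen_ball.mem_nhds (by simpa using ha1.trans_lt (by norm_num))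
    have hsub : Metric.ball a 3 ⊆ Metric.ball (0 : ℂ) 4 :=
      Metric.ball_subset_ball' (by rw [dist_zero_right]; linarith)
    -- Dividing out one zero gains a factor `3 = 4 - 1`: by the Schwarz lemma within distance 3 of
    -- `a`, and directly from `|z - a| ≥ 3` beyond it.
    have hbound : ∀ z ∈ Metric.ball (0 : ℂ) 4, ‖dslope h a z‖ ≤ B / 3 := by
      intro z hz4
      by_cases hza : z ∈ Metric.ball a 3
      · refine Complex.norm_dslope_le_div_of_mapsTo_ball (hd.mono hsub) ?_ hza
        intro w hw
        simpa [hha] using hB w (hsub hw)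
      · have h3 : 3 ≤ ‖z - a‖ := by simpa [dist_eq_norm] using hza
        have hne : z ≠ a := by
          rintro rfl
          norm_num at h3
        have hB0 : 0 ≤ B := (norm_nonneg _).trans (hB z hz4)
        rw [dslope_of_ne _ hne, slope_def_field, hha, sub_zero, norm_div]
        exact div_le_div₀ hB0 (hB z hz4) (by norm_num) h3
    have hrec := ih (fun b hb => hs b (Finset.mem_insert_of_mem hb))
      ((Complex.differentiableOn_dslope ha4).2 hd) hbound (fun b hb => by
        have hne : b ≠ a := by
          rintro rfl
          exact ha hb
        rw [dslope_of_ne _ hne, slope_def_field, hha, hz b (Finset.mem_insert_of_mem hb)]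
        simp)
    have h0 : h 0 = (0 - a) * dslope h a 0 := by
      have := sub_smul_dslope h a 0
      rw [hha, sub_zero, smul_eq_mul] at this
      exact this.symm
    rw [h0, norm_mul, zero_sub, norm_neg, Finset.card_insert_of_notMem ha, pow_succ', ← div_div]
    exact (mul_le_of_le_one_left (norm_nonneg _) ha1).trans hrec

/-- Sup bound for the Lagrange interpolant of small values at well-separated nodes. -/
lemma norm_eval_interpolate_le {d : ℝ} (hd : 0 < d) {n : ℕ} {x : ℕ → ℝ}
    (hx : ∀ i < n, x i + d ≤ x (i + 1)) (hx1 : ∀ i ≤ n, |x i| ≤ 1) {y : ℕ → ℂ} {η : ℝ}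
    (hy : ∀ i ≤ n, ‖y i‖ ≤ η) {z : ℂ} (hz : ‖z‖ ≤ 4) :
    ‖(Lagrange.interpolate (Finset.range (n + 1)) (fun i => (x i : ℂ)) y).eval z‖
      ≤ η * ((10 / d) ^ n / n.factorial) := by
  have hη : 0 ≤ η := (norm_nonneg _).trans (hy 0 (Nat.zero_le n))
  have hbasis : ∀ i ∈ Finset.range (n + 1),
      ‖(Lagrange.basis (Finset.range (n + 1)) (fun i => (x i : ℂ)) i).eval z‖
        ≤ (5 / d) ^ n / n.factorial * (n.choose i) := by
    intro i hi
    have hin : i ≤ n := Nat.lt_succ_iff.1 (Finset.mem_range.1 hi)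
    rw [Lagrange.basis, Polynomial.eval_prod, norm_prod]
    calc ∏ j ∈ (Finset.range (n + 1)).erase i,
          ‖(Lagrange.basisDivisor (x i : ℂ) (x j : ℂ)).eval z‖
        ≤ ∏ j ∈ (Finset.range (n + 1)).erase i, ((5 / d) * |(i : ℝ) - j|⁻¹) := by
          refine Finset.prod_le_prod (fun _ _ => norm_nonneg _) fun j hj => ?_
          have hji : j ≠ i := Finset.ne_of_mem_erase hj
          have hjn : j ≤ n := Nat.lt_succ_iff.1 (Finset.mem_range.1 (Finset.mem_of_mem_erase hj))
          have hpos : 0 < |(i : ℝ) - j| := abs_pos.2 (sub_ne_zero.2 (by exact_mod_cast hji.symm))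
          have h1 : ‖((x i : ℂ) - x j)⁻¹‖ ≤ (d * |(i : ℝ) - j|)⁻¹ := by
            rw [norm_inv, ← Complex.ofReal_sub, Complex.norm_real, Real.norm_eq_abs]
            exact inv_anti₀ (by positivity) (mul_abs_sub_le_of_gaps hx hin hjn)
          have h2 : ‖z - x j‖ ≤ 5 := by
            refine (norm_sub_le _ _).trans ?_
            rw [Complex.norm_real, Real.norm_eq_abs]
            linarith [hx1 j hjn]
          simp only [Lagrange.basisDivisor, Polynomial.eval_mul, Polynomial.eval_C,
            Polynomial.eval_sub, Polynomial.eval_X, norm_mul]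
          calc ‖((x i : ℂ) - x j)⁻¹‖ * ‖z - x j‖ ≤ (d * |(i : ℝ) - j|)⁻¹ * 5 := by gcongr
            _ = _ := by rw [mul_inv]; ring
      _ = (5 / d) ^ n / n.factorial * (n.choose i) := by
          rw [Finset.prod_mul_distrib, Finset.prod_const, Finset.card_erase_of_mem hi,
            Finset.card_range, Nat.add_sub_cancel, Finset.prod_inv_distrib,
            prod_erase_abs_sub_eq hin]
          have hch : ((n.choose i : ℕ) : ℝ) * i.factorial * (n - i).factorial = n.factorial := by
            exact_mod_cast Nat.choose_mul_factorial_mul_factorial hin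
          have h1 : (i.factorial : ℝ) ≠ 0 := by positivity
          have h2 : ((n - i).factorial : ℝ) ≠ 0 := by positivity
          have h3 : (n.factorial : ℝ) ≠ 0 := by positivity
          rw [mul_inv, div_mul_eq_mul_div, eq_div_iff h3, ← hch]
          field_simp
  rw [Lagrange.interpolate_apply, Polynomial.eval_finsetSum]
  calc ‖∑ i ∈ Finset.range (n + 1), (Polynomial.C (y i)
        * Lagrange.basis (Finset.range (n + 1)) (fun i => (x i : ℂ)) i).eval z‖
      ≤ ∑ i ∈ Finset.range (n + 1), η * ((5 / d) ^ n / n.factorial * (n.choose i)) := by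
        refine (norm_sum_le _ _).trans (Finset.sum_le_sum fun i hi => ?_)
        rw [Polynomial.eval_mul, Polynomial.eval_C, norm_mul]
        exact mul_le_mul (hy i (Nat.lt_succ_iff.1 (Finset.mem_range.1 hi))) (hbasis i hi)
          (norm_nonneg _) hη
    _ = η * ((10 / d) ^ n / n.factorial) := by
        rw [← Finset.mul_sum, ← Finset.mul_sum]
        have : ∑ i ∈ Finset.range (n + 1), (n.choose i : ℝ) = 2 ^ n := by
          exact_mod_cast Nat.sum_range_choose n
        rw [this, show (10 : ℝ) / d = 5 / d * 2 by ring, mul_pow]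
        ring

/-- One-variable Cartan-type estimate: a bounded holomorphic function that is not too small at the
origin is very small only on a small subset of the unit interval. -/
theorem volume_norm_le_exp_neg_le {f : ℂ → ℂ} (hd : DifferentiableOn ℂ f (Metric.ball 0 4))
    {K t : ℝ} (hK : 1 ≤ K) (hub : ∀ z ∈ Metric.ball (0 : ℂ) 4, ‖f z‖ ≤ Real.exp K)
    (h0 : Real.exp (-K) ≤ ‖f 0‖) {E : Set ℝ} (hE : E ⊆ Set.Icc 0 1)
    (hfE : ∀ s ∈ E, ‖f (s : ℂ)‖ ≤ Real.exp (-t)) :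
    MeasureTheory.volume E ≤ ENNReal.ofReal (28 * Real.exp 2 * Real.exp (-t / (3 * K))) := by
  have hvol1 : MeasureTheory.volume E ≤ 1 := by
    simpa using MeasureTheory.measure_mono (μ := MeasureTheory.volume) hE
  rcases lt_or_ge t 0 with ht | ht
  · refine hvol1.trans ?_
    rw [← ENNReal.ofReal_one]
    apply ENNReal.ofReal_le_ofReal
    have h1 : 1 ≤ Real.exp (-t / (3 * K)) :=
      Real.one_le_exp (div_nonneg (by linarith) (by linarith))
    have h2 : 1 ≤ Real.exp 2 := Real.one_le_exp (by norm_num)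
    nlinarith
  -- `n ≥ 2K` makes the gain `3 ^ (n + 1)` beat `exp (2K + 1)`, while `n < 2K + 1 ≤ 3K` produces the
  -- exponent `t / (3K)`.
  set n := ⌈2 * K⌉₊ with hn
  have hn1 : 2 * K ≤ n := Nat.le_ceil _
  have hn2 : (n : ℝ) < 2 * K + 1 := Nat.ceil_lt_add_one (by linarith)
  have hn0 : (0 : ℝ) < n := by linarith
  -- Solves `exp (-t) * (28 / m) ^ n = exp (-K - 2)`, the wanted size of the interpolant; 28 exceeds
  -- `10 * e`, the `e` coming from `n ^ n / n! ≤ e ^ n`.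
  set m := 28 * Real.exp (-(t - K - 2) / n) with hm
  have hm0 : 0 < m := by positivity
  suffices hs : MeasureTheory.volume E ≤ ENNReal.ofReal m by
    refine hs.trans (ENNReal.ofReal_le_ofReal ?_)
    rw [hm, mul_assoc, ← Real.exp_add]
    gcongr
    have e1 : (K + 2) / n ≤ 2 := by rw [div_le_iff₀ hn0]; linarith
    have e2 : t / (3 * K) ≤ t / n := by gcongr; linarith
    have e3 : -(t - K - 2) / n = (K + 2) / n - t / n := by ring
    rw [e3, neg_div]
    linarith
  by_contra hcon
  push Not at hcon
  have hdn : (n : ℝ) * (m / n) = m := by field_simp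
  obtain ⟨x, hxE, hgap⟩ := exists_separated_points (d := m / n) (by positivity) n E
    (bddBelow_Icc.mono hE) (by rwa [hdn])
  have hd0 : 0 < m / n := by positivity
  have hx1 : ∀ i ≤ n, |x i| ≤ 1 := fun i hi => by
    have := hE (hxE i hi)
    rw [abs_of_nonneg this.1]
    exact this.2
  have hinj : Set.InjOn (fun i => (x i : ℂ)) (Finset.range (n + 1) : Set ℕ) := by
    intro i hi j hj hij
    have hi' : i ≤ n := Nat.lt_succ_iff.1 (Finset.mem_range.1 (Finset.mem_coe.1 hi))
    have hj' : j ≤ n := Nat.lt_succ_iff.1 (Finset.mem_range.1 (Finset.mem_coe.1 hj))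
    have hij' : x i = x j := Complex.ofReal_injective hij
    have h := mul_abs_sub_le_of_gaps hgap hi' hj'
    rw [hij', sub_self, abs_zero] at h
    have h2 : |(i : ℝ) - j| ≤ 0 := nonpos_of_mul_nonpos_right h hd0
    have h3 : (i : ℝ) = j := sub_eq_zero.1 (abs_eq_zero.1 (le_antisymm h2 (abs_nonneg _)))
    exact_mod_cast h3
  set p := Lagrange.interpolate (Finset.range (n + 1)) (fun i => (x i : ℂ)) (fun i => f (x i))
    with hp
  have hpb : ∀ z : ℂ, ‖z‖ ≤ 4 → ‖p.eval z‖ ≤ Real.exp (-K - 2) := by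
    intro z hz
    refine (norm_eval_interpolate_le hd0 hgap hx1 (fun i hi => hfE _ (hxE i hi)) hz).trans ?_
    have e1 : (10 / (m / n)) ^ n / n.factorial ≤ (28 / m) ^ n := by
      have h1 : (n : ℝ) ^ n / n.factorial ≤ Real.exp n :=
        Real.pow_div_factorial_le_exp n (Nat.cast_nonneg n) n
      calc (10 / (m / n)) ^ n / n.factorial = (10 / m) ^ n * ((n : ℝ) ^ n / n.factorial) := by
            rw [div_div_eq_mul_div, mul_div_right_comm, mul_pow]
            ring
        _ ≤ (10 / m) ^ n * Real.exp n := by gcongr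
        _ = (10 / m * Real.exp 1) ^ n := by rw [mul_pow, ← Real.exp_nat_mul, mul_one]
        _ ≤ (28 / m) ^ n := by
            gcongr
            rw [div_mul_eq_mul_div]
            gcongr
            linarith [Real.exp_one_lt_d9]
    have e2 : (28 / m) ^ n = Real.exp (t - K - 2) := by
      rw [hm, div_mul_eq_div_div, div_self (by norm_num), one_div, ← Real.exp_neg,
        ← Real.exp_nat_mul]
      congr 1
      field_simp
    calc Real.exp (-t) * ((10 / (m / n)) ^ n / n.factorial)
        ≤ Real.exp (-t) * Real.exp (t - K - 2) := by rw [← e2]; gcongr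
      _ = Real.exp (-K - 2) := by rw [← Real.exp_add]; congr 1; ring
  have hcard : ((Finset.range (n + 1)).image (fun i => (x i : ℂ))).card = n + 1 := by
    rw [Finset.card_image_of_injOn hinj, Finset.card_range]
  have hmain := norm_apply_zero_le_of_zeros ((Finset.range (n + 1)).image (fun i => (x i : ℂ)))
    (h := fun z => f z - p.eval z) (B := Real.exp K + Real.exp (-K - 2))
    (fun a ha => by
      obtain ⟨i, hi, rfl⟩ := Finset.mem_image.1 ha
      rw [Complex.norm_real]
      exact hx1 i (Nat.lt_succ_iff.1 (Finset.mem_range.1 hi)))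
    (hd.sub p.differentiable.differentiableOn)
    (fun z hz => (norm_sub_le _ _).trans
      (add_le_add (hub z hz) (hpb z (by simpa using (Metric.mem_ball.1 hz).le))))
    (fun a ha => by
      obtain ⟨i, hi, rfl⟩ := Finset.mem_image.1 ha
      rw [sub_eq_zero, hp, Lagrange.eval_interpolate_at_node _ hinj hi])
  rw [hcard] at hmain
  have h3 : Real.exp (2 * K + 1) ≤ 3 ^ (n + 1) := by
    calc Real.exp (2 * K + 1) ≤ Real.exp ((n + 1 : ℕ) * 1) := by
          apply Real.exp_le_exp.2
          push_cast
          linarith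
      _ = Real.exp 1 ^ (n + 1) := Real.exp_nat_mul 1 (n + 1)
      _ ≤ 3 ^ (n + 1) := by
          gcongr
          linarith [Real.exp_one_lt_d9]
  have hf0 : ‖f 0‖ ≤ ‖f 0 - p.eval 0‖ + ‖p.eval 0‖ := by
    simpa using norm_add_le (f 0 - p.eval 0) (p.eval 0)
  have hp0 := hpb 0 (by simp)
  have hB : (Real.exp K + Real.exp (-K - 2)) / 3 ^ (n + 1)
      ≤ Real.exp (-K - 1) + Real.exp (-K - 2) * Real.exp (-1) := by
    refine (div_le_div_of_nonneg_left (by positivity) (Real.exp_pos _) h3).trans ?_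
    rw [add_div, ← Real.exp_sub, ← Real.exp_sub, ← Real.exp_add]
    exact add_le_add (Real.exp_le_exp.2 (by linarith)) (Real.exp_le_exp.2 (by linarith))
  have hlow : Real.exp (-K) ≤ Real.exp (-K - 1) + Real.exp (-K - 2) * Real.exp (-1)
      + Real.exp (-K - 2) := by linarith
  have hE1 : Real.exp (-K - 1) = Real.exp (-K) * Real.exp (-1) := by rw [← Real.exp_add]; ring_nf
  have hE2 : Real.exp (-K - 2) = Real.exp (-K) * Real.exp (-1) * Real.exp (-1) := by
    rw [← Real.exp_add, ← Real.exp_add]; ring_nf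
  -- After division by `exp (-K)` the contradiction is `1 ≤ q + q³ + q²` with `q = 1/e`, impossible
  -- for `q < 0.4`.
  have hlt : Real.exp (-1) < 0.4 := by
    rw [Real.exp_neg]
    rw [inv_lt_comm₀ (Real.exp_pos _) (by norm_num)]
    linarith [Real.exp_one_gt_d9]
  rw [hE1, hE2] at hlow
  have hpos := Real.exp_pos (-K)
  have hq := Real.exp_pos (-1)
  set q := Real.exp (-1)
  have : 1 ≤ q + q * q * q + q * q := by
    by_contra hc
    push Not at hc
    nlinarith
  nlinarith [mul_pos hq hq]

/-! ### Polar coordinates: from rays to volumes. -/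

open MeasureTheory in
lemma volumeIoiPow_le (n : ℕ) {ρ : ℝ} {A : Set (Set.Ioi (0 : ℝ))}
    (hA : MeasurableSet A) (hAρ : ∀ s ∈ A, s.1 ≤ ρ) :
    Measure.volumeIoiPow n A ≤ ENNReal.ofReal (ρ ^ n) * volume (Subtype.val '' A) := by
  rw [Measure.volumeIoiPow, withDensity_apply _ hA]
  calc ∫⁻ r in A, ENNReal.ofReal (r.1 ^ n) ∂(Measure.comap Subtype.val volume)
      ≤ ∫⁻ r in A, ENNReal.ofReal (ρ ^ n) ∂(Measure.comap Subtype.val volume) := by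
        refine setLIntegral_mono measurable_const fun r hr => ?_
        apply ENNReal.ofReal_le_ofReal
        have := r.2.out.le
        gcongr
        exact hAρ r hr
    _ = ENNReal.ofReal (ρ ^ n) * volume (Subtype.val '' A) := by
        rw [setLIntegral_const, comap_subtype_coe_apply measurableSet_Ioi]

open MeasureTheory in
/-- A measurable set contained in a ball around the origin and having small intersection with
every ray has small measure. -/
lemma addHaar_le_of_radial_slices {F : Type*} [NormedAddCommGroup F] [NormedSpace ℝ F]
    [MeasurableSpace F] [BorelSpace F] [FiniteDimensional ℝ F] [Nontrivial F]
    (μ : Measure F) [μ.IsAddHaarMeasure] {E : Set F} (hE : MeasurableSet E) {ρ q : ℝ}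
    (hρ : 0 ≤ ρ) (hEρ : ∀ x ∈ E, ‖x‖ ≤ ρ)
    (hslice : ∀ ω : F, ‖ω‖ = 1 → volume {s : ℝ | 0 < s ∧ s • ω ∈ E} ≤ ENNReal.ofReal (ρ * q)) :
    μ E ≤ ENNReal.ofReal (ρ ^ Module.finrank ℝ F * q)
      * (Module.finrank ℝ F * μ (Metric.ball 0 1)) := by
  set A : Set (({0}ᶜ : Set F)) := Subtype.val ⁻¹' E with hAdef
  have hA : MeasurableSet A := measurable_subtype_coe hE
  have h1 : μ E ≤ μ.comap (Subtype.val : ({0}ᶜ : Set F) → F) A := by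
    rw [comap_subtype_coe_apply (measurableSet_singleton _).compl, hAdef,
      Subtype.image_preimage_coe, Set.inter_comm, ← Set.sdiff_eq,
      measure_sdiff_null (measure_singleton _)]
  set B : Set (Metric.sphere (0 : F) 1 × Set.Ioi (0 : ℝ)) :=
    (homeomorphUnitSphereProd F).symm ⁻¹' A with hBdef
  have hB : MeasurableSet B := (homeomorphUnitSphereProd F).symm.measurable hA
  have h2 : μ.comap (Subtype.val : ({0}ᶜ : Set F) → F) A
      = (μ.toSphere.prod (Measure.volumeIoiPow (Module.finrank ℝ F - 1))) B := by
    rw [← (μ.measurePreserving_homeomorphUnitSphereProd).measure_preimage hB.nullMeasurableSet,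
      hBdef, ← Set.preimage_comp, Homeomorph.symm_comp_self, Set.preimage_id]
  refine h1.trans ?_
  rw [h2, Measure.prod_apply hB]
  have hd : Module.finrank ℝ F - 1 + 1 = Module.finrank ℝ F :=
    Nat.sub_add_cancel Module.finrank_pos
  have hpt : ∀ ω : Metric.sphere (0 : F) 1,
      Measure.volumeIoiPow (Module.finrank ℝ F - 1) (Prod.mk ω ⁻¹' B)
        ≤ ENNReal.ofReal (ρ ^ Module.finrank ℝ F * q) := by
    intro ω
    have hω : ‖(ω : F)‖ = 1 := by simp
    have hmem : ∀ s : Set.Ioi (0 : ℝ), s ∈ Prod.mk ω ⁻¹' B ↔ s.1 • (ω : F) ∈ E := by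
      intro s
      simp [hBdef, hAdef]
    refine (volumeIoiPow_le (ρ := ρ) _ (measurable_prodMk_left hB) fun s hs => ?_).trans ?_
    · have := hEρ _ ((hmem s).1 hs)
      rwa [norm_smul, hω, mul_one, Real.norm_of_nonneg s.2.out.le] at this
    · calc _ ≤ ENNReal.ofReal (ρ ^ (Module.finrank ℝ F - 1)) * ENNReal.ofReal (ρ * q) := by
            gcongr
            refine (measure_mono ?_).trans (hslice ω hω)
            rintro _ ⟨s, hs, rfl⟩
            exact ⟨s.2.out, (hmem s).1 hs⟩
        _ = _ := by
            rw [← ENNReal.ofReal_mul (by positivity), ← mul_assoc, ← pow_succ, hd]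
  refine (lintegral_mono hpt).trans ?_
  rw [lintegral_const, Measure.toSphere_apply_univ]

open MeasureTheory in
/-- The version of `addHaar_le_of_radial_slices` for Lebesgue measure and sup-norm balls with an
arbitrary centre. -/
lemma volume_le_of_radial_slices {J : ℕ} (hJ : 1 ≤ J) (a : Fin J → ℝ) {E : Set (Fin J → ℝ)}
    (hE : MeasurableSet E) {ρ q : ℝ} (hρ : 0 ≤ ρ) (hEρ : ∀ x ∈ E, ‖x - a‖ ≤ ρ)
    (hslice : ∀ ω : Fin J → ℝ, ‖ω‖ = 1 →
      volume {s : ℝ | 0 < s ∧ a + s • ω ∈ E} ≤ ENNReal.ofReal (ρ * q)) :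
    volume E ≤ ENNReal.ofReal (ρ ^ J * q * (J * 2 ^ J)) := by
  have : Nonempty (Fin J) := ⟨⟨0, hJ⟩⟩
  have h := addHaar_le_of_radial_slices (volume : Measure (Fin J → ℝ))
    (E := (fun x => a + x) ⁻¹' E) (measurable_const_add a hE) hρ
    (fun x hx => by simpa using hEρ _ hx) hslice
  -- The unit sphere is that of the sup norm; its total mass is the dimension times the volume `2 ^
  -- J` of the unit ball.
  rw [measure_preimage_add, Module.finrank_fin_fun, Real.volume_pi_ball _ one_pos] at h
  refine h.trans (le_of_eq ?_)
  rw [Fintype.card_fin, mul_one, ← ENNReal.ofReal_natCast, ← ENNReal.ofReal_mul (by positivity),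
    ← ENNReal.ofReal_mul' (by positivity)]

/-! ### Determinants and inverses through eigenvalues. -/

section SpectralBounds

variable {n : Type*} [Fintype n] [DecidableEq n]

lemma norm_le_of_mem_roots_charpoly (A : Matrix n n ℂ) {μ : ℂ} (hμ : μ ∈ A.charpoly.roots) :
    ‖μ‖ ≤ ‖A‖ := by
  have hs := Matrix.mem_spectrum_of_isRoot_charpoly (Polynomial.isRoot_of_mem_roots hμ)
  have : Nonempty n := by
    by_contra h
    rw [not_nonempty_iff] at h
    simp [Matrix.charpoly] at hμ
  exact spectrum.norm_le_norm_of_mem hs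

lemma norm_multiset_prod_le_pow {s : Multiset ℂ} {b : ℝ} (hs : ∀ μ ∈ s, ‖μ‖ ≤ b) :
    ‖s.prod‖ ≤ b ^ s.card := by
  induction s using Multiset.induction_on with
  | empty => simp
  | cons a s ih =>
    rw [Multiset.prod_cons, Multiset.card_cons, pow_succ', norm_mul]
    have ha := hs a (Multiset.mem_cons_self a s)
    exact mul_le_mul ha (ih fun μ hμ => hs μ (Multiset.mem_cons_of_mem hμ)) (norm_nonneg _)
      ((norm_nonneg _).trans ha)

lemma card_roots_charpoly (A : Matrix n n ℂ) : A.charpoly.roots.card = Fintype.card n := by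
  rw [← (IsAlgClosed.splits A.charpoly).natDegree_eq_card_roots, Matrix.charpoly_natDegree_eq_dim]

lemma norm_det_le_norm_pow (A : Matrix n n ℂ) : ‖A.det‖ ≤ ‖A‖ ^ Fintype.card n := by
  rw [Matrix.det_eq_prod_roots_charpoly, ← card_roots_charpoly A]
  exact norm_multiset_prod_le_pow fun μ hμ => norm_le_of_mem_roots_charpoly A hμ

/-- For a self-adjoint matrix, a large inverse forces a small determinant. -/
lemma norm_inv_mul_norm_det_le {A : Matrix n n ℂ} (hA : A.IsHermitian) (hu : IsUnit A) {b : ℝ}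
    (hb : 1 ≤ b) (hAb : ‖A‖ ≤ b) : ‖A⁻¹‖ * ‖A.det‖ ≤ b ^ Fintype.card n := by
  rcases isEmpty_or_nonempty n with h | h
  · rw [Subsingleton.elim A⁻¹ 0, norm_zero, zero_mul]
    positivity
  have hsa : IsSelfAdjoint A⁻¹ := hA.inv
  -- Self-adjointness makes the norm of the inverse the modulus of an eigenvalue `μ`; then `μ⁻¹` is
  -- a factor of `det A` and cancels, leaving factors at most `b`.
  obtain ⟨μ, hμ, hμn⟩ := spectrum.exists_nnnorm_eq_spectralRadius A⁻¹
  rw [hsa.spectralRadius_eq_nnnorm] at hμn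
  have hnorm : ‖μ‖ = ‖A⁻¹‖ := by
    have : ‖μ‖₊ = ‖A⁻¹‖₊ := by exact_mod_cast hμn
    exact congrArg NNReal.toReal this
  obtain ⟨u, rfl⟩ := hu
  rw [← Matrix.coe_units_inv] at hμ hnorm ⊢
  have hμ0 : μ ≠ 0 := spectrum.ne_zero_of_mem_of_unit hμ
  have hmem : μ⁻¹ ∈ spectrum ℂ (u : Matrix n n ℂ) := by
    have := (spectrum.inv_mem_iff (r := Units.mk0 μ hμ0) (a := u⁻¹)).1 hμ
    simpa using this
  have hroot : μ⁻¹ ∈ (u : Matrix n n ℂ).charpoly.roots :=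
    (Polynomial.mem_roots (Matrix.charpoly_monic _).ne_zero).2
      (Matrix.mem_spectrum_iff_isRoot_charpoly.1 hmem)
  rw [Matrix.det_eq_prod_roots_charpoly, ← Multiset.prod_erase hroot, norm_mul, norm_inv,
    ← mul_assoc, ← hnorm, mul_inv_cancel₀ (norm_ne_zero_iff.2 hμ0), one_mul]
  refine (norm_multiset_prod_le_pow (b := b) fun ν hν =>
    (norm_le_of_mem_roots_charpoly _ (Multiset.mem_of_mem_erase hν)).trans hAb).trans ?_
  refine pow_le_pow_right₀ hb ?_
  rw [← card_roots_charpoly (u : Matrix n n ℂ)]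
  exact Multiset.card_le_card (Multiset.erase_le _ _)

end SpectralBounds

/-! ### Stability of invertibility. -/

section Neumann

variable {R : Type*} [NormedRing R]

lemma isUnit_of_norm_inverse_mul_norm_sub_lt [HasSummableGeomSeries R] {a b : R} (ha : IsUnit a)
    (h : ‖Ring.inverse a‖ * ‖b - a‖ < 1) : IsUnit b := by
  have h1 : b = a * (1 - Ring.inverse a * (a - b)) := by
    rw [mul_sub, ← mul_assoc, Ring.mul_inverse_cancel _ ha]
    simp
  rw [h1]
  refine ha.mul (isUnit_one_sub_of_norm_lt_one ?_)
  refine (norm_mul_le _ _).trans_lt ?_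
  rwa [norm_sub_rev]

/-- By the resolvent identity the inverse of `b` is bounded by `c` plus half its own norm, which is
absorbed on the left. -/
lemma norm_inverse_le_two_mul {a b : R} (ha : IsUnit a) (hb : IsUnit b) {c : ℝ}
    (hc : ‖Ring.inverse a‖ ≤ c) (h : c * ‖b - a‖ ≤ 1 / 2) : ‖Ring.inverse b‖ ≤ 2 * c := by
  have h1 : Ring.inverse b = Ring.inverse a - Ring.inverse b * ((b - a) * Ring.inverse a) := by
    rw [sub_mul, Ring.mul_inverse_cancel _ ha, mul_sub, ← mul_assoc,
      Ring.inverse_mul_cancel _ hb]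
    simp
  have h2 : ‖Ring.inverse b‖ ≤ c + ‖Ring.inverse b‖ * (1 / 2) := by
    calc ‖Ring.inverse b‖ ≤ ‖Ring.inverse a‖ + ‖Ring.inverse b * ((b - a) * Ring.inverse a)‖ := by
          conv_lhs => rw [h1]
          exact norm_sub_le _ _
      _ ≤ c + ‖Ring.inverse b‖ * (‖b - a‖ * ‖Ring.inverse a‖) :=
          add_le_add hc ((norm_mul_le _ _).trans
            (mul_le_mul_of_nonneg_left (norm_mul_le _ _) (norm_nonneg _)))
      _ ≤ c + ‖Ring.inverse b‖ * (1 / 2) := by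
          gcongr
          refine le_trans ?_ h
          rw [mul_comm]
          gcongr
  linarith

end Neumann

/-! ### Coordinate isometries and Schur complements. -/

section CoordinateEmbedding

variable {N : ℕ} (P : Fin N → Prop)

/-- The isometric embedding of the coordinates satisfying `P`, as an `N × P` matrix. -/
def coordEmb : Matrix (Fin N) {i // P i} ℂ :=
  (1 : Matrix (Fin N) (Fin N) ℂ).submatrix id Subtype.val

lemma conjTranspose_coordEmb_mul_mul (A : Matrix (Fin N) (Fin N) ℂ) :
    (coordEmb P).conjTranspose * A * coordEmb P = A.submatrix Subtype.val Subtype.val := by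
  ext i j
  simp [coordEmb, Matrix.mul_apply, Matrix.one_apply]

lemma conjTranspose_coordEmb_mul_self [DecidableEq {i // P i}] :
    (coordEmb P).conjTranspose * coordEmb P = 1 := by
  ext i j
  simp [coordEmb, Matrix.mul_apply, Matrix.one_apply, Subtype.ext_iff, eq_comm]

lemma conjTranspose_coordEmb_mul_compl :
    (coordEmb P).conjTranspose * coordEmb (fun i => ¬ P i) = 0 := by
  ext i j
  have : (i : Fin N) ≠ j := fun h => j.2 (h ▸ i.2)
  simp [coordEmb, Matrix.mul_apply, Matrix.one_apply, this]

lemma coordEmb_mul_conjTranspose_add [Fintype {i // P i}] [Fintype {i // ¬ P i}] :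
    coordEmb P * (coordEmb P).conjTranspose
      + coordEmb (fun i => ¬ P i) * (coordEmb (fun i => ¬ P i)).conjTranspose = 1 := by
  classical
  ext i j
  simp only [coordEmb, Matrix.add_apply, Matrix.mul_apply, Matrix.conjTranspose_apply,
    Matrix.submatrix_apply, id, Matrix.one_apply]
  have h := Fintype.sum_subtype_add_sum_subtype P
    (fun k : Fin N => (if i = k then (1 : ℂ) else 0) * star (if j = k then (1 : ℂ) else 0))
  have h' : ∑ k : Fin N, (if i = k then (1 : ℂ) else 0) * star (if j = k then (1 : ℂ) else 0)
      = if i = j then 1 else 0 := by simp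
  rw [← h', ← h]
  congr!

end CoordinateEmbedding

section SchurComplement

variable {l m k : Type*} [Fintype l] [Fintype k] [DecidableEq k]

lemma norm_le_one_of_conjTranspose_mul_self [Fintype m] [DecidableEq m] {E : Matrix l m ℂ} (hE : E.conjTranspose * E = 1) :
    ‖E‖ ≤ 1 := by
  have h := Matrix.l2_opNorm_conjTranspose_mul_self E
  rw [hE] at h
  -- Only an inequality: the identity has norm 0 when `m` is empty.
  have h1 : ‖(1 : Matrix m m ℂ)‖ ≤ 1 := by
    rw [← Matrix.diagonal_one, Matrix.l2_opNorm_diagonal]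
    exact (pi_norm_le_iff_of_nonneg zero_le_one).2 fun i => by simp
  nlinarith [norm_nonneg E]

lemma norm_mul_mul_le [Fintype m] [DecidableEq l] {E : Matrix m l ℂ} {G : Matrix l k ℂ} (hE : ‖E‖ ≤ 1) (hG : ‖G‖ ≤ 1)
    (A : Matrix l l ℂ) : ‖E * A * G‖ ≤ ‖A‖ := by
  refine (Matrix.l2_opNorm_mul _ _).trans ?_
  refine (mul_le_of_le_one_right (norm_nonneg _) hG).trans ?_
  exact (Matrix.l2_opNorm_mul _ _).trans (mul_le_of_le_one_left (norm_nonneg _) hE)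

/-- The Schur complement of `A` with respect to a splitting of the coordinate space into the ranges
of the isometries `E` and `G`. -/
noncomputable def schurCompl (E : Matrix l m ℂ) (G : Matrix l k ℂ) (A : Matrix l l ℂ) :
    Matrix m m ℂ :=
  E.conjTranspose * A * E - (E.conjTranspose * A * G) * (G.conjTranspose * A * G)⁻¹
    * (G.conjTranspose * A * E)

lemma isHermitian_schurCompl (E : Matrix l m ℂ) (G : Matrix l k ℂ) {A : Matrix l l ℂ}
    (hA : A.IsHermitian) : (schurCompl E G A).IsHermitian := by
  rw [Matrix.IsHermitian, schurCompl]
  simp only [Matrix.conjTranspose_sub, Matrix.conjTranspose_mul, Matrix.conjTranspose_conjTranspose,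
    Matrix.conjTranspose_nonsing_inv, hA.eq, Matrix.mul_assoc]

lemma norm_schurCompl_le [DecidableEq l] [Fintype m] [DecidableEq m]
    {E : Matrix l m ℂ} {G : Matrix l k ℂ} (hE : E.conjTranspose * E = 1)
    (hG : G.conjTranspose * G = 1) {A : Matrix l l ℂ} {a b : ℝ} (ha : ‖A‖ ≤ a)
    (hb : ‖(G.conjTranspose * A * G)⁻¹‖ ≤ b) : ‖schurCompl E G A‖ ≤ a + a * b * a := by
  have hE1 := norm_le_one_of_conjTranspose_mul_self hE
  have hG1 := norm_le_one_of_conjTranspose_mul_self hG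
  have hE2 : ‖E.conjTranspose‖ ≤ 1 := (Matrix.l2_opNorm_conjTranspose E).trans_le hE1
  have hG2 : ‖G.conjTranspose‖ ≤ 1 := (Matrix.l2_opNorm_conjTranspose G).trans_le hG1
  have ha0 : 0 ≤ a := (norm_nonneg _).trans ha
  have hb0 : 0 ≤ b := (norm_nonneg _).trans hb
  refine (norm_sub_le _ _).trans (add_le_add ((norm_mul_mul_le hE2 hE1 A).trans ha) ?_)
  refine (Matrix.l2_opNorm_mul _ _).trans ?_
  refine mul_le_mul ((Matrix.l2_opNorm_mul _ _).trans ?_)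
    ((norm_mul_mul_le hG2 hE1 A).trans ha) (norm_nonneg _) (by positivity)
  exact mul_le_mul ((norm_mul_mul_le hE2 hG1 A).trans ha) hb (norm_nonneg _) ha0

variable [Fintype m] [DecidableEq l] {E : Matrix l m ℂ} {G : Matrix l k ℂ} {A : Matrix l l ℂ}

/-- Block elimination: the correction term kills the `G`-component of `A * E`, and what remains in
the range of `E` is the Schur complement. -/
lemma mul_schur_column (hEG : E * E.conjTranspose + G * G.conjTranspose = 1)
    (hD : IsUnit (G.conjTranspose * A * G)) :
    A * (E - G * (G.conjTranspose * A * G)⁻¹ * (G.conjTranspose * A * E)) = E * schurCompl E G A := by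
  have hdet := (Matrix.isUnit_iff_isUnit_det _).1 hD
  have h1 : G.conjTranspose * (A * (E - G * (G.conjTranspose * A * G)⁻¹
      * (G.conjTranspose * A * E))) = 0 := by
    have : G.conjTranspose * (A * (E - G * (G.conjTranspose * A * G)⁻¹ * (G.conjTranspose * A * E)))
        = G.conjTranspose * A * E - (G.conjTranspose * A * G) * (G.conjTranspose * A * G)⁻¹
          * (G.conjTranspose * A * E) := by
      simp only [Matrix.mul_sub, Matrix.mul_assoc]
    rw [this, Matrix.mul_nonsing_inv _ hdet, Matrix.one_mul, sub_self]
  have h2 : E.conjTranspose * (A * (E - G * (G.conjTranspose * A * G)⁻¹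
      * (G.conjTranspose * A * E))) = schurCompl E G A := by
    simp only [schurCompl, Matrix.mul_sub, Matrix.mul_assoc]
  generalize A * (E - G * (G.conjTranspose * A * G)⁻¹ * (G.conjTranspose * A * E)) = X at h1 h2 ⊢
  calc X = (E * E.conjTranspose + G * G.conjTranspose) * X := by rw [hEG, Matrix.one_mul]
    _ = E * (E.conjTranspose * X) + G * (G.conjTranspose * X) := by
        simp only [Matrix.add_mul, Matrix.mul_assoc]
    _ = E * schurCompl E G A := by rw [h1, h2, Matrix.mul_zero, add_zero]

variable [DecidableEq m]

/-- Apply `E.conjTranspose * A⁻¹` to `mul_schur_column`. The inverse of the Schur complement is thus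
a compression of `A⁻¹`, with no larger norm. -/
lemma isUnit_schurCompl (hE : E.conjTranspose * E = 1) (hE0 : E.conjTranspose * G = 0)
    (hEG : E * E.conjTranspose + G * G.conjTranspose = 1)
    (hD : IsUnit (G.conjTranspose * A * G)) (hA : IsUnit A) :
    IsUnit (schurCompl E G A) ∧ (schurCompl E G A)⁻¹ = E.conjTranspose * A⁻¹ * E := by
  have hdet := (Matrix.isUnit_iff_isUnit_det _).1 hA
  have key : (E.conjTranspose * A⁻¹ * E) * schurCompl E G A = 1 := by
    rw [Matrix.mul_assoc, ← mul_schur_column hEG hD, Matrix.mul_assoc, ← Matrix.mul_assoc A⁻¹,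
      Matrix.nonsing_inv_mul _ hdet, Matrix.one_mul, Matrix.mul_sub, hE, Matrix.mul_assoc G,
      ← Matrix.mul_assoc _ G, hE0, Matrix.zero_mul, sub_zero]
  exact ⟨IsUnit.of_mul_eq_one_right _ key, Matrix.inv_eq_left_inv key⟩

/-- The block inversion formula; it transfers a bound on the inverse of the small Schur complement
back to `A`. -/
lemma inv_eq_of_isUnit_schurCompl (hEG : E * E.conjTranspose + G * G.conjTranspose = 1)
    (hD : IsUnit (G.conjTranspose * A * G)) (hS : IsUnit (schurCompl E G A)) :
    IsUnit A ∧ A⁻¹ = G * (G.conjTranspose * A * G)⁻¹ * G.conjTranspose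
      + (E - G * (G.conjTranspose * A * G)⁻¹ * (G.conjTranspose * A * E)) * (schurCompl E G A)⁻¹
        * (E.conjTranspose - (E.conjTranspose * A * G) * (G.conjTranspose * A * G)⁻¹
          * G.conjTranspose) := by
  have hdet := (Matrix.isUnit_iff_isUnit_det _).1 hS
  have hdetD := (Matrix.isUnit_iff_isUnit_det _).1 hD
  have h1 : A * (G * (G.conjTranspose * A * G)⁻¹ * G.conjTranspose)
      = E * (E.conjTranspose * A * G * (G.conjTranspose * A * G)⁻¹ * G.conjTranspose)
        + G * G.conjTranspose := by
    calc A * (G * (G.conjTranspose * A * G)⁻¹ * G.conjTranspose)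
        = (E * E.conjTranspose + G * G.conjTranspose)
          * (A * (G * (G.conjTranspose * A * G)⁻¹ * G.conjTranspose)) := by
            rw [hEG, Matrix.one_mul]
      _ = E * (E.conjTranspose * A * G * (G.conjTranspose * A * G)⁻¹ * G.conjTranspose)
          + G * ((G.conjTranspose * A * G) * (G.conjTranspose * A * G)⁻¹ * G.conjTranspose) := by
            simp only [Matrix.add_mul, Matrix.mul_assoc]
      _ = _ := by rw [Matrix.mul_nonsing_inv _ hdetD, Matrix.one_mul]
  have key : A * (G * (G.conjTranspose * A * G)⁻¹ * G.conjTranspose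
      + (E - G * (G.conjTranspose * A * G)⁻¹ * (G.conjTranspose * A * E)) * (schurCompl E G A)⁻¹
        * (E.conjTranspose - (E.conjTranspose * A * G) * (G.conjTranspose * A * G)⁻¹
          * G.conjTranspose)) = 1 := by
    rw [Matrix.mul_add, h1, ← Matrix.mul_assoc A, ← Matrix.mul_assoc A, mul_schur_column hEG hD,
      Matrix.mul_assoc E, Matrix.mul_nonsing_inv _ hdet, Matrix.mul_one, Matrix.mul_sub, ← hEG]
    abel
  exact ⟨IsUnit.of_mul_eq_one _ key, Matrix.inv_eq_right_inv key⟩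

lemma norm_inv_le_of_isUnit_schurCompl (hE : E.conjTranspose * E = 1)
    (hG : G.conjTranspose * G = 1) (hEG : E * E.conjTranspose + G * G.conjTranspose = 1)
    (hD : IsUnit (G.conjTranspose * A * G)) (hS : IsUnit (schurCompl E G A)) {a b : ℝ}
    (ha : ‖A‖ ≤ a) (hb : ‖(G.conjTranspose * A * G)⁻¹‖ ≤ b) :
    ‖A⁻¹‖ ≤ b + (1 + a * b) ^ 2 * ‖(schurCompl E G A)⁻¹‖ := by
  have hE1 := norm_le_one_of_conjTranspose_mul_self hE
  have hG1 := norm_le_one_of_conjTranspose_mul_self hG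
  have hE2 : ‖E.conjTranspose‖ ≤ 1 := (Matrix.l2_opNorm_conjTranspose E).trans_le hE1
  have hG2 : ‖G.conjTranspose‖ ≤ 1 := (Matrix.l2_opNorm_conjTranspose G).trans_le hG1
  have ha0 : 0 ≤ a := (norm_nonneg _).trans ha
  have hb0 : 0 ≤ b := (norm_nonneg _).trans hb
  rw [(inv_eq_of_isUnit_schurCompl hEG hD hS).2]
  have hcol : ‖E - G * (G.conjTranspose * A * G)⁻¹ * (G.conjTranspose * A * E)‖ ≤ 1 + a * b := by
    refine (norm_sub_le _ _).trans (add_le_add hE1 ?_)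
    refine (Matrix.l2_opNorm_mul _ _).trans ?_
    rw [mul_comm]
    exact mul_le_mul ((norm_mul_mul_le hG2 hE1 A).trans ha)
      ((Matrix.l2_opNorm_mul _ _).trans ((mul_le_of_le_one_left (norm_nonneg _) hG1).trans hb))
      (norm_nonneg _) ha0
  have hrow : ‖E.conjTranspose - (E.conjTranspose * A * G) * (G.conjTranspose * A * G)⁻¹
      * G.conjTranspose‖ ≤ 1 + a * b := by
    refine (norm_sub_le _ _).trans (add_le_add hE2 ?_)
    refine (Matrix.l2_opNorm_mul _ _).trans ((mul_le_of_le_one_right (norm_nonneg _) hG2).trans ?_)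
    refine (Matrix.l2_opNorm_mul _ _).trans ?_
    exact mul_le_mul ((norm_mul_mul_le hE2 hG1 A).trans ha) hb (norm_nonneg _) ha0
  refine (norm_add_le _ _).trans (add_le_add ((norm_mul_mul_le hG1 hG2 _).trans hb) ?_)
  refine (Matrix.l2_opNorm_mul _ _).trans ?_
  calc _ ≤ ((1 + a * b) * ‖(schurCompl E G A)⁻¹‖) * (1 + a * b) := by
        refine mul_le_mul ((Matrix.l2_opNorm_mul _ _).trans ?_) hrow (norm_nonneg _) (by positivity)
        exact mul_le_mul_of_nonneg_right hcol (norm_nonneg _)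
    _ = _ := by ring

end SchurComplement

/-! ### Holomorphy of the Schur determinant. -/

section Differentiability

variable {l m k p : Type*} [Fintype l]

lemma differentiableOn_matrix_mul_apply {s : Set ℂ} {A : ℂ → Matrix k l ℂ} {B : ℂ → Matrix l m ℂ}
    (hA : ∀ i j, DifferentiableOn ℂ (fun z => A z i j) s)
    (hB : ∀ i j, DifferentiableOn ℂ (fun z => B z i j) s) (i : k) (j : m) :
    DifferentiableOn ℂ (fun z => (A z * B z) i j) s := by
  simp only [Matrix.mul_apply]
  exact DifferentiableOn.fun_sum fun x _ => (hA i x).mul (hB x j)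

lemma differentiableOn_const_mul_mul_const_apply [Fintype p] {s : Set ℂ} {A : ℂ → Matrix l p ℂ}
    (hA : ∀ i j, DifferentiableOn ℂ (fun z => A z i j) s) (E : Matrix k l ℂ) (G : Matrix p m ℂ)
    (i : k) (j : m) : DifferentiableOn ℂ (fun z => (E * A z * G) i j) s := by
  have h1 : ∀ i j, DifferentiableOn ℂ (fun z => (E * A z) i j) s :=
    differentiableOn_matrix_mul_apply (A := fun _ => E) (fun _ _ => differentiableOn_const _) hA
  exact differentiableOn_matrix_mul_apply (B := fun _ => G) h1
    (fun _ _ => differentiableOn_const _) i j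

lemma differentiableOn_matrix_det [DecidableEq l] {s : Set ℂ} {A : ℂ → Matrix l l ℂ}
    (hA : ∀ i j, DifferentiableOn ℂ (fun z => A z i j) s) :
    DifferentiableOn ℂ (fun z => (A z).det) s := by
  simp only [Matrix.det_apply]
  refine DifferentiableOn.fun_sum fun σ _ => ?_
  exact (DifferentiableOn.fun_finsetProd fun i _ => hA (σ i) i).const_smul _

lemma differentiableOn_matrix_inv_apply [DecidableEq l] {s : Set ℂ} {A : ℂ → Matrix l l ℂ}
    (hA : ∀ i j, DifferentiableOn ℂ (fun z => A z i j) s) (hu : ∀ z ∈ s, IsUnit (A z)) (i j : l) :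
    DifferentiableOn ℂ (fun z => (A z)⁻¹ i j) s := by
  -- Cramer's rule: each entry is a quotient of determinants with nonvanishing denominator.
  simp only [Matrix.inv_def, Matrix.smul_apply, Ring.inverse_eq_inv, smul_eq_mul,
    Matrix.adjugate_apply]
  refine ((differentiableOn_matrix_det hA).inv fun z hz =>
    ((Matrix.isUnit_iff_isUnit_det _).1 (hu z hz)).ne_zero).mul ?_
  refine differentiableOn_matrix_det fun a b => ?_
  simp only [Matrix.updateRow_apply]
  split_ifs
  · exact differentiableOn_const _
  · exact hA a b

lemma differentiableOn_det_schurCompl [Fintype m] [DecidableEq m] [Fintype k] [DecidableEq k]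
    {s : Set ℂ} (E : Matrix l m ℂ) (G : Matrix l k ℂ) {A : ℂ → Matrix l l ℂ}
    (hA : ∀ i j, DifferentiableOn ℂ (fun z => A z i j) s)
    (hu : ∀ z ∈ s, IsUnit (G.conjTranspose * A z * G)) :
    DifferentiableOn ℂ (fun z => (schurCompl E G (A z)).det) s := by
  refine differentiableOn_matrix_det fun i j => ?_
  simp only [schurCompl, Matrix.sub_apply]
  refine (differentiableOn_const_mul_mul_const_apply hA _ _ i j).sub ?_
  have hinv := differentiableOn_matrix_inv_apply
    (differentiableOn_const_mul_mul_const_apply hA G.conjTranspose G) hu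
  exact differentiableOn_matrix_mul_apply (differentiableOn_matrix_mul_apply
    (differentiableOn_const_mul_mul_const_apply hA _ _) hinv)
    (differentiableOn_const_mul_mul_const_apply hA _ _) i j

end Differentiability

/-! ### The extended norm of the inverse. -/

section InvNorm

variable {n : Type*} [Fintype n] [DecidableEq n]

lemma isUnit_of_invNorm_le_ofReal {A : Matrix n n ℂ} {b : ℝ} (hb : 0 ≤ b)
    (h : invNorm A ≤ ENNReal.ofReal b) : IsUnit A ∧ ‖A⁻¹‖ ≤ b := by
  rw [invNorm] at h
  split_ifs at h with hu
  · exact ⟨hu, (ENNReal.ofReal_le_ofReal_iff hb).1 h⟩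
  · exact absurd (top_le_iff.1 h) ENNReal.ofReal_ne_top

lemma isUnit_of_invNorm_lt_ofReal {A : Matrix n n ℂ} {b : ℝ}
    (h : invNorm A < ENNReal.ofReal b) : IsUnit A ∧ ‖A⁻¹‖ < b := by
  rw [invNorm] at h
  split_ifs at h with hu
  · exact ⟨hu, (ENNReal.ofReal_lt_ofReal_iff_of_nonneg (norm_nonneg _)).1 h⟩
  · exact absurd h not_top_lt

lemma le_norm_inv_of_ofReal_le_invNorm {A : Matrix n n ℂ} (hA : IsUnit A) {b : ℝ}
    (h : ENNReal.ofReal b ≤ invNorm A) : b ≤ ‖A⁻¹‖ := by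
  rw [invNorm, if_pos hA] at h
  exact (ENNReal.ofReal_le_ofReal_iff (norm_nonneg _)).1 h

/-- Units form an open set on which inversion is continuous. This makes the bad set closed, hence
measurable, as polar integration needs. -/
lemma isOpen_setOf_invNorm_lt (c : ENNReal) : IsOpen {A : Matrix n n ℂ | invNorm A < c} := by
  have h : {A : Matrix n n ℂ | invNorm A < c}
      = {A | IsUnit A} ∩ (fun A => ENNReal.ofReal ‖Ring.inverse A‖) ⁻¹' Set.Iio c := by
    ext A
    by_cases hu : IsUnit A <;>
      simp [invNorm, hu, Matrix.nonsing_inv_eq_ringInverse]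
  rw [h]
  refine ContinuousOn.isOpen_inter_preimage ?_ Units.isOpen isOpen_Iio
  rintro A ⟨u, rfl⟩
  exact (ENNReal.continuous_ofReal.continuousAt.comp
    (NormedRing.inverse_continuousAt u).norm).continuousWithinAt

end InvNorm

/-! ### Size of the Schur determinant. -/

section SchurDeterminant

variable {l m k : Type*} [Fintype l] [Fintype m] [Fintype k]
  [DecidableEq l] [DecidableEq m] [DecidableEq k] {E : Matrix l m ℂ} {G : Matrix l k ℂ}

lemma isUnit_compression_of_norm_sub_le (hG : G.conjTranspose * G = 1) {A₀ A : Matrix l l ℂ} {b : ℝ}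
    (hu : IsUnit (G.conjTranspose * A₀ * G)) (hb : ‖(G.conjTranspose * A₀ * G)⁻¹‖ ≤ b)
    (hA : b * ‖A - A₀‖ ≤ 1 / 2) :
    IsUnit (G.conjTranspose * A * G) ∧ ‖(G.conjTranspose * A * G)⁻¹‖ ≤ 2 * b := by
  have hG1 := norm_le_one_of_conjTranspose_mul_self hG
  have hG2 : ‖G.conjTranspose‖ ≤ 1 := (Matrix.l2_opNorm_conjTranspose G).trans_le hG1
  have hb0 : 0 ≤ b := (norm_nonneg _).trans hb
  have hsub : ‖G.conjTranspose * A * G - G.conjTranspose * A₀ * G‖ ≤ ‖A - A₀‖ := by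
    rw [← Matrix.sub_mul, ← Matrix.mul_sub]
    exact norm_mul_mul_le hG2 hG1 _
  rw [Matrix.nonsing_inv_eq_ringInverse] at hb ⊢
  have hle : b * ‖G.conjTranspose * A * G - G.conjTranspose * A₀ * G‖ ≤ 1 / 2 :=
    (mul_le_mul_of_nonneg_left hsub hb0).trans hA
  have hu' : IsUnit (G.conjTranspose * A * G) := by
    refine isUnit_of_norm_inverse_mul_norm_sub_lt hu ?_
    have := mul_le_mul_of_nonneg_right hb
      (norm_nonneg (G.conjTranspose * A * G - G.conjTranspose * A₀ * G))
    linarith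
  exact ⟨hu', norm_inverse_le_two_mul hu hu' hb hle⟩

variable {A : Matrix l l ℂ} {a b M : ℝ}

lemma norm_det_schurCompl_le (hE : E.conjTranspose * E = 1) (hG : G.conjTranspose * G = 1)
    (hm : (Fintype.card m : ℝ) ≤ M) (ha : ‖A‖ ≤ a) (hb : ‖(G.conjTranspose * A * G)⁻¹‖ ≤ b)
    (hab : 1 ≤ a + a * b * a) : ‖(schurCompl E G A).det‖ ≤ (a + a * b * a) ^ M := by
  refine (norm_det_le_norm_pow _).trans ?_
  refine (pow_le_pow_left₀ (norm_nonneg _) (norm_schurCompl_le hE hG ha hb) _).trans ?_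
  rw [← Real.rpow_natCast]
  exact Real.rpow_le_rpow_of_exponent_le hab hm

/-- The inverse of the Schur complement is a compression of `A⁻¹`, so its determinant is at most `a
^ M`. This supplies the lower bound at the good point. -/
lemma rpow_neg_le_norm_det_schurCompl (hE : E.conjTranspose * E = 1)
    (hE0 : E.conjTranspose * G = 0) (hEG : E * E.conjTranspose + G * G.conjTranspose = 1)
    (hD : IsUnit (G.conjTranspose * A * G)) (hA : IsUnit A)
    (hm : (Fintype.card m : ℝ) ≤ M) (ha : ‖A⁻¹‖ ≤ a) (ha1 : 1 ≤ a) :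
    a ^ (-M) ≤ ‖(schurCompl E G A).det‖ := by
  have hE1 := norm_le_one_of_conjTranspose_mul_self hE
  have hE2 : ‖E.conjTranspose‖ ≤ 1 := (Matrix.l2_opNorm_conjTranspose E).trans_le hE1
  obtain ⟨hS, hinv⟩ := isUnit_schurCompl hE hE0 hEG hD hA
  have hdet := (Matrix.isUnit_iff_isUnit_det _).1 hS
  have h1 : ‖(schurCompl E G A)⁻¹.det‖ ≤ a ^ M := by
    refine (norm_det_le_norm_pow _).trans ?_
    refine (pow_le_pow_left₀ (norm_nonneg _) (b := a) ?_ _).trans ?_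
    · rw [hinv]
      exact (norm_mul_mul_le hE2 hE1 _).trans ha
    · rw [← Real.rpow_natCast]
      exact Real.rpow_le_rpow_of_exponent_le ha1 hm
  rw [Matrix.det_nonsing_inv, Ring.inverse_eq_inv, norm_inv] at h1
  rw [Real.rpow_neg (by linarith)]
  exact inv_le_of_inv_le₀ (norm_pos_iff.2 hdet.ne_zero) h1

/-- Block inversion forces the Schur complement to have a large inverse as well; being Hermitian of
size at most `M`, it then has a small determinant. If it is singular, the determinant vanishes. -/
lemma norm_det_schurCompl_le_of_le_invNorm (hE : E.conjTranspose * E = 1)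
    (hG : G.conjTranspose * G = 1) (hEG : E * E.conjTranspose + G * G.conjTranspose = 1)
    (hD : IsUnit (G.conjTranspose * A * G)) (hA : A.IsHermitian)
    (hm : (Fintype.card m : ℝ) ≤ M) (ha : ‖A‖ ≤ a) (hb : ‖(G.conjTranspose * A * G)⁻¹‖ ≤ b)
    (hab : 1 ≤ a + a * b * a) {ε : ℝ} (hε : 0 < ε) (hbad : ENNReal.ofReal ε⁻¹ ≤ invNorm A) :
    ‖(schurCompl E G A).det‖ ≤ ε * ((b + (1 + a * b) ^ 2) * (a + a * b * a) ^ M) := by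
  have hb0 : 0 ≤ b := (norm_nonneg _).trans hb
  have hβ : 0 ≤ (a + a * b * a) ^ M := Real.rpow_nonneg (by linarith) _
  by_cases hS : IsUnit (schurCompl E G A)
  · have h1 := le_norm_inv_of_ofReal_le_invNorm (inv_eq_of_isUnit_schurCompl hEG hD hS).1 hbad
    have h2 := norm_inv_le_of_isUnit_schurCompl hE hG hEG hD hS ha hb
    have h3 := norm_det_schurCompl_le hE hG hm ha hb hab
    have h4 : ‖(schurCompl E G A)⁻¹‖ * ‖(schurCompl E G A).det‖ ≤ (a + a * b * a) ^ M := by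
      refine (norm_inv_mul_norm_det_le (isHermitian_schurCompl E G hA) hS hab
        (norm_schurCompl_le hE hG ha hb)).trans ?_
      rw [← Real.rpow_natCast]
      exact Real.rpow_le_rpow_of_exponent_le hab hm
    rw [← inv_mul_le_iff₀ hε]
    calc ε⁻¹ * ‖(schurCompl E G A).det‖
        ≤ (b + (1 + a * b) ^ 2 * ‖(schurCompl E G A)⁻¹‖) * ‖(schurCompl E G A).det‖ :=
          mul_le_mul_of_nonneg_right (h1.trans h2) (norm_nonneg _)
      _ = b * ‖(schurCompl E G A).det‖
          + (1 + a * b) ^ 2 * (‖(schurCompl E G A)⁻¹‖ * ‖(schurCompl E G A).det‖) := by ring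
      _ ≤ b * (a + a * b * a) ^ M + (1 + a * b) ^ 2 * (a + a * b * a) ^ M := by gcongr
      _ = _ := by ring
  · have h0 : (schurCompl E G A).det = 0 := by
      by_contra h
      exact hS ((Matrix.isUnit_iff_isUnit_det _).2 (isUnit_iff_ne_zero.2 h))
    rw [h0, norm_zero]
    positivity

end SchurDeterminant

/-! ### Geometry of the cubes. -/

section Domain

variable {J N : ℕ}

/-- The inclusion `ℝ^J → ℂ^J`. -/
def toComplexVec (x : Fin J → ℝ) : Fin J → ℂ := fun i => (x i : ℂ)

lemma norm_toComplexVec (x : Fin J → ℝ) : ‖toComplexVec x‖ = ‖x‖ := by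
  simp [toComplexVec, Pi.norm_def, Complex.nnnorm_real]

lemma toComplexVec_sub (x y : Fin J → ℝ) :
    toComplexVec (x - y) = toComplexVec x - toComplexVec y := by
  ext i
  simp [toComplexVec]

lemma ball_subset_complexBox {δ : ℝ} {x₀ : Fin J → ℝ} (hx₀ : x₀ ∈ realCube J (δ / 2)) :
    Metric.ball (toComplexVec x₀) (δ / 2) ⊆ complexBox J δ := by
  intro z hz i
  have h1 : ‖z i - x₀ i‖ ≤ δ / 2 := by
    have := norm_le_pi_norm (z - toComplexVec x₀) i
    rw [mem_ball_iff_norm] at hz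
    exact this.trans hz.le
  have h2 := hx₀ i
  have hre := (Complex.abs_re_le_norm (z i - x₀ i)).trans h1
  have him := (Complex.abs_im_le_norm (z i - x₀ i)).trans h1
  simp only [Complex.sub_re, Complex.sub_im, Complex.ofReal_re, Complex.ofReal_im,
    sub_zero] at hre him
  rw [abs_le] at h2 hre him ⊢
  rw [abs_le]
  constructor <;> constructor <;> linarith

lemma closedBall_subset_realCube {δ r : ℝ} {x₀ : Fin J → ℝ} (hx₀ : x₀ ∈ realCube J (δ / 2))
    (hr : r ≤ δ / 2) : Metric.closedBall x₀ r ⊆ realCube J δ := by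
  intro x hx i
  have h1 : |x i - x₀ i| ≤ r :=
    (norm_le_pi_norm (x - x₀) i).trans (by rwa [mem_closedBall_iff_norm] at hx)
  have h2 := hx₀ i
  rw [abs_le] at h1 h2 ⊢
  constructor <;> linarith

/-- Schwarz lemma: `F` maps the ball of radius `δ / 2` into a ball of radius `2 * B` about its
central value. -/
lemma norm_sub_center_le {F : (Fin J → ℂ) → Matrix (Fin N) (Fin N) ℂ} {δ B : ℝ}
    (hF : AnalyticOnNhd ℂ F (complexBox J δ)) (hB : ∀ z ∈ complexBox J δ, ‖F z‖ ≤ B)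
    {x₀ : Fin J → ℝ} (hx₀ : x₀ ∈ realCube J (δ / 2)) {z : Fin J → ℂ}
    (hz : z ∈ Metric.ball (toComplexVec x₀) (δ / 2)) :
    ‖F z - F (toComplexVec x₀)‖ ≤ 4 * B / δ * ‖z - toComplexVec x₀‖ := by
  have hsub := ball_subset_complexBox hx₀
  have hδ : 0 < δ / 2 := Metric.nonempty_ball.1 ⟨z, hz⟩
  have h := Complex.dist_le_div_mul_dist_of_mapsTo_ball (R₂ := 2 * B)
    (hF.differentiableOn.mono hsub) (fun w hw => by
      rw [mem_closedBall_iff_norm]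
      have h1 := hB w (hsub hw)
      have h2 := hB _ (hsub (Metric.mem_ball_self hδ))
      linarith [norm_sub_le (F w) (F (toComplexVec x₀))]) hz
  rw [dist_eq_norm, dist_eq_norm] at h
  rwa [show 2 * B / (δ / 2) = 4 * B / δ by field_simp; ring] at h

lemma realCube_subset_iUnion_closedBall {δ : ℝ} (hδ : 0 < δ) {n : ℕ} (hn : 0 < n) :
    ∃ c : (Fin J → Fin n) → (Fin J → ℝ), (∀ k, c k ∈ realCube J (δ / 2)) ∧
      realCube J (δ / 2) ⊆ ⋃ k, Metric.closedBall (c k) (δ / (2 * n)) := by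
  have hn' : (0 : ℝ) < n := Nat.cast_pos.2 hn
  refine ⟨fun k i => -(δ / 2) + (2 * (k i : ℕ) + 1) * (δ / (2 * n)), fun k i => ?_, fun x hx => ?_⟩
  · have h1 : ((k i : ℕ) : ℝ) + 1 ≤ n := by exact_mod_cast (k i).2
    have h2 : (2 * ((k i : ℕ) : ℝ) + 1) * (δ / (2 * n)) ≤ δ := by
      rw [← mul_div_assoc, div_le_iff₀ (by positivity)]
      nlinarith
    have h3 : 0 ≤ (2 * ((k i : ℕ) : ℝ) + 1) * (δ / (2 * n)) := by positivity
    rw [abs_le]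
    constructor <;> linarith
  · have hex : ∀ i, ∃ k : Fin n,
        |x i - (-(δ / 2) + (2 * (k : ℕ) + 1) * (δ / (2 * n)))| ≤ δ / (2 * n) := by
      intro i
      have hxi := abs_le.1 (hx i)
      set y := (x i + δ / 2) * n / δ with hy
      have hxy : x i = y * (δ / n) - δ / 2 := by
        rw [hy]
        field_simp
        ring
      have hy0 : 0 ≤ y := div_nonneg (mul_nonneg (by linarith) hn'.le) hδ.le
      have hyn : y ≤ n := by
        rw [hy, div_le_iff₀ hδ]
        nlinarith
      -- The floor serves except at the right endpoint `y = n`, which belongs to the last cell.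
      have hk : ∃ k : Fin n, ((k : ℕ) : ℝ) ≤ y ∧ y ≤ (k : ℕ) + 1 := by
        rcases hyn.lt_or_eq with h | h
        · exact ⟨⟨⌊y⌋₊, (Nat.floor_lt hy0).2 h⟩, Nat.floor_le hy0, (Nat.lt_floor_add_one y).le⟩
        · refine ⟨⟨n - 1, by omega⟩, ?_, ?_⟩
          · rw [h]
            exact_mod_cast Nat.sub_le n 1
          · rw [h]
            exact_mod_cast (by omega : n ≤ n - 1 + 1)
      obtain ⟨k, hk1, hk2⟩ := hk
      refine ⟨k, ?_⟩
      have e : x i - (-(δ / 2) + (2 * (k : ℕ) + 1) * (δ / (2 * n)))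
          = (2 * (y - (k : ℕ)) - 1) * (δ / (2 * n)) := by
        rw [hxy]
        field_simp
        ring
      rw [e, abs_mul, abs_of_pos (by positivity : 0 < δ / (2 * (n : ℝ)))]
      refine mul_le_of_le_one_left (by positivity) ?_
      rw [abs_le]
      constructor <;> linarith
    choose k hk using hex
    refine Set.mem_iUnion.2 ⟨k, ?_⟩
    rw [mem_closedBall_iff_norm, pi_norm_le_iff_of_nonneg (by positivity)]
    exact hk

end Domain

/-! ### The estimate on one small cube. -/

lemma volume_pos_mul_preimage_le {S : Set ℝ} {ρ q : ℝ} (hρ : 0 < ρ)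
    (h : MeasureTheory.volume {u : ℝ | ρ * u ∈ S} ≤ ENNReal.ofReal q) :
    MeasureTheory.volume S ≤ ENNReal.ofReal (ρ * q) := by
  have h1 := Real.volume_preimage_mul_left hρ.ne' S
  rw [abs_of_pos (inv_pos.2 hρ)] at h1
  have h2 : MeasureTheory.volume S
      = ENNReal.ofReal ρ * (ENNReal.ofReal ρ⁻¹ * MeasureTheory.volume S) := by
    rw [← mul_assoc, ← ENNReal.ofReal_mul hρ.le, mul_inv_cancel₀ hρ.ne', ENNReal.ofReal_one, one_mul]
  rw [h2, ← h1, ENNReal.ofReal_mul hρ.le]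
  exact mul_le_mul_right h _

/-- The local estimate on a small cube containing a point where the inverse is controlled. -/
lemma volume_large_invNorm_inter_closedBall_le {J N : ℕ} (hJ : 1 ≤ J)
    {F : (Fin J → ℂ) → Matrix (Fin N) (Fin N) ℂ} {δ B₁ B₂ Λ M ε K r : ℝ} (hδ : 0 < δ)
    (hB₁ : 1 ≤ B₁) (hB₂ : 1 ≤ B₂) (hF : AnalyticOnNhd ℂ F (complexBox J δ))
    (hFB : ∀ z ∈ complexBox J δ, ‖F z‖ ≤ B₁) {x₀ : Fin J → ℝ} (hx₀ : x₀ ∈ realCube J (δ / 2))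
    {V : Finset (Fin N)} (hV : (V.card : ℝ) ≤ M)
    (hVinv : invNorm (compressOff (F (toComplexVec x₀)) V) ≤ ENNReal.ofReal B₂)
    (hr : 0 < r) (hrδ : r * (72 * B₁ * B₂) ≤ δ) {x₁ : Fin J → ℝ}
    (hx₁ : x₁ ∈ Metric.closedBall x₀ r) (hu : IsUnit (F (toComplexVec x₁)))
    (hinv : ‖(F (toComplexVec x₁))⁻¹‖ ≤ Λ) (hΛ : 1 ≤ Λ) (hK : 1 ≤ K)
    (hK1 : (B₁ + B₁ * (2 * B₂) * B₁) ^ M ≤ Real.exp K)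
    (hK2 : (2 * B₂ + (1 + B₁ * (2 * B₂)) ^ 2) * (B₁ + B₁ * (2 * B₂) * B₁) ^ M
      ≤ Real.exp (2 * K))
    (hK3 : Real.exp (-K) ≤ Λ ^ (-M)) (hε : 0 < ε) {S : Set (Fin J → ℝ)} (hSm : MeasurableSet S)
    (hSr : S ⊆ Metric.closedBall x₀ r)
    (hS : ∀ x ∈ S, (F (toComplexVec x)).IsHermitian ∧
      ENNReal.ofReal ε⁻¹ ≤ invNorm (F (toComplexVec x))) :
    MeasureTheory.volume S ≤ ENNReal.ofReal ((2 * r) ^ J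
      * (28 * Real.exp 2 * Real.exp (-(Real.log ε⁻¹ - 2 * K) / (3 * K))) * (J * 2 ^ J)) := by
  set E := coordEmb (fun i : Fin N => i ∈ V) with hEdef
  set G := coordEmb (fun i : Fin N => ¬ i ∈ V) with hGdef
  have hE : E.conjTranspose * E = 1 := conjTranspose_coordEmb_mul_self _
  have hG : G.conjTranspose * G = 1 := conjTranspose_coordEmb_mul_self _
  have hE0 : E.conjTranspose * G = 0 := conjTranspose_coordEmb_mul_compl _
  have hEG : E * E.conjTranspose + G * G.conjTranspose = 1 :=
    coordEmb_mul_conjTranspose_add (fun i : Fin N => i ∈ V)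
  have hm : (Fintype.card {i // i ∈ V} : ℝ) ≤ M := by rwa [Fintype.card_coe]
  have hBpos : 0 < B₁ * B₂ := by positivity
  have hβ : 1 ≤ B₁ + B₁ * (2 * B₂) * B₁ := by
    have : 0 ≤ B₁ * (2 * B₂) * B₁ := by positivity
    linarith
  obtain ⟨hD₀, hD₀b⟩ := isUnit_of_invNorm_le_ofReal (by linarith) hVinv
  have hcomp : compressOff (F (toComplexVec x₀)) V
      = G.conjTranspose * F (toComplexVec x₀) * G :=
    (conjTranspose_coordEmb_mul_mul (fun i : Fin N => ¬ i ∈ V) _).symm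
  rw [hcomp] at hD₀ hD₀b
  -- Radius `9r = r + 4 * 2r` contains the complex discs used below, and `72 = 2 * 4 * 9` makes the
  -- perturbation at most one half.
  have hnear : ∀ z, ‖z - toComplexVec x₀‖ ≤ 9 * r → z ∈ complexBox J δ ∧
      IsUnit (G.conjTranspose * F z * G) ∧ ‖(G.conjTranspose * F z * G)⁻¹‖ ≤ 2 * B₂ := by
    intro z hz
    have h9 : 9 * r < δ / 2 := by nlinarith [one_le_mul_of_one_le_of_one_le hB₁ hB₂]
    have hzb : z ∈ Metric.ball (toComplexVec x₀) (δ / 2) := by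
      rw [mem_ball_iff_norm]
      linarith
    refine ⟨ball_subset_complexBox hx₀ hzb, isUnit_compression_of_norm_sub_le hG hD₀ hD₀b ?_⟩
    calc B₂ * ‖F z - F (toComplexVec x₀)‖
        ≤ B₂ * (4 * B₁ / δ * (9 * r)) := by
          gcongr
          refine (norm_sub_center_le hF hFB hx₀ hzb).trans ?_
          gcongr
      _ = (r * (72 * B₁ * B₂)) / δ * (1 / 2) := by ring
      _ ≤ 1 * (1 / 2) := by
          gcongr
          exact (div_le_one hδ).2 hrδ
      _ = 1 / 2 := one_mul _
  have hnearx : ∀ x ∈ Metric.closedBall x₀ r, ‖toComplexVec x - toComplexVec x₀‖ ≤ r := by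
    intro x hx
    rw [← toComplexVec_sub, norm_toComplexVec]
    rwa [mem_closedBall_iff_norm] at hx
  have hxnorm : ∀ x ∈ S, ‖x - x₁‖ ≤ 2 * r := by
    intro x hx
    have h1 := hSr hx
    rw [← dist_eq_norm]
    rw [Metric.mem_closedBall] at h1 hx₁
    linarith [dist_triangle_right x x₁ x₀]
  refine volume_le_of_radial_slices hJ x₁ hSm (by positivity) hxnorm fun ω hω => ?_
  refine volume_pos_mul_preimage_le (by positivity) ?_
  -- Complexified ray from the good point, scaled so that parameters in `[0, 1]` reach all of `S`,
  -- which lies within `2r` of `x₁`.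
  set γ : ℂ → (Fin J → ℂ) := fun ζ => toComplexVec x₁ + (ζ * (2 * r : ℝ)) • toComplexVec ω
    with hγ
  have hγreal : ∀ u : ℝ, γ u = toComplexVec (x₁ + (2 * r * u) • ω) := by
    intro u
    ext i
    simp [hγ, toComplexVec]
    exact Or.inl (by ring)
  have hγ0 : γ 0 = toComplexVec x₁ := by simp [hγ]
  have hγnear : ∀ ζ ∈ Metric.ball (0 : ℂ) 4, ‖γ ζ - toComplexVec x₀‖ ≤ 9 * r := by
    intro ζ hζ
    have hζ4 : ‖ζ‖ ≤ 4 := by simpa using (Metric.mem_ball.1 hζ).le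
    have e : γ ζ - toComplexVec x₀
        = (toComplexVec x₁ - toComplexVec x₀) + (ζ * (2 * r : ℝ)) • toComplexVec ω := by
      simp only [hγ]
      abel
    rw [e]
    refine (norm_add_le _ _).trans ?_
    rw [norm_smul, norm_toComplexVec, hω, norm_mul, Complex.norm_real,
      Real.norm_of_nonneg (by positivity : 0 ≤ 2 * r), mul_one]
    have := hnearx x₁ hx₁
    nlinarith
  have hγd : Differentiable ℂ γ := by
    simp only [hγ]
    fun_prop
  have hFγ : ∀ i j, DifferentiableOn ℂ (fun ζ => F (γ ζ) i j) (Metric.ball 0 4) := by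
    intro i j
    have h1 : DifferentiableOn ℂ (fun ζ => F (γ ζ)) (Metric.ball 0 4) :=
      hF.differentiableOn.comp hγd.differentiableOn fun ζ hζ => (hnear _ (hγnear ζ hζ)).1
    exact (LinearMap.toContinuousLinearMap
      (Matrix.entryLinearMap ℂ ℂ i j)).differentiable.comp_differentiableOn h1
  -- Here `t = log ε⁻¹ - 2K`, since `exp (-t) = ε * exp (2K)`.
  refine volume_norm_le_exp_neg_le (f := fun ζ => (schurCompl E G (F (γ ζ))).det)
    (differentiableOn_det_schurCompl E G hFγ fun ζ hζ => (hnear _ (hγnear ζ hζ)).2.1)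
    hK (fun ζ hζ => ?_) ?_ (fun u hu => ?_) (fun u hu => ?_)
  · obtain ⟨h1, -, h3⟩ := hnear _ (hγnear ζ hζ)
    exact (norm_det_schurCompl_le hE hG hm (hFB _ h1) h3 hβ).trans hK1
  · obtain ⟨-, h2, -⟩ := hnear _ (hγnear 0 (Metric.mem_ball_self (by norm_num)))
    rw [hγ0] at h2 ⊢
    exact hK3.trans (rpow_neg_le_norm_det_schurCompl hE hE0 hEG h2 hu hm hinv hΛ)
  · obtain ⟨hu0, huS⟩ := hu
    have h1 := hxnorm _ huS
    rw [add_sub_cancel_left, norm_smul, hω, mul_one, Real.norm_of_nonneg hu0.le] at h1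
    exact ⟨(pos_of_mul_pos_right hu0 (by positivity)).le,
      le_of_mul_le_mul_left (by rwa [mul_one]) (by positivity : 0 < 2 * r)⟩
  · obtain ⟨-, huS⟩ := hu
    obtain ⟨h1, h2, h3⟩ := hnear (toComplexVec (x₁ + (2 * r * u) • ω))
      ((hnearx _ (hSr huS)).trans (by linarith))
    simp only [hγreal]
    refine (norm_det_schurCompl_le_of_le_invNorm hE hG hEG h2 (hS _ huS).1 hm (hFB _ h1) h3 hβ hε
      (hS _ huS).2).trans ?_
    refine (mul_le_mul_of_nonneg_left hK2 hε.le).trans (le_of_eq ?_)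
    rw [neg_sub, Real.exp_sub, Real.log_inv, Real.exp_neg, Real.exp_log hε, div_inv_eq_mul, mul_comm]

/-! ### Constants. -/

/-- The exponent constant in the estimate, depending only on the sup bound. -/
noncomputable def cartanExponent (B : ℝ) : ℝ :=
  2 + Real.log (11 * B ^ 2) / Real.log (1 + 1 / B)

section Constants

variable {B₁ : ℝ}

lemma log_one_add_inv_pos (hB₁ : 1 ≤ B₁) : 0 < Real.log (1 + 1 / B₁) :=
  Real.log_pos (by linarith [show 0 < 1 / B₁ by positivity])

lemma one_le_log_eleven_mul_sq (hB₁ : 1 ≤ B₁) : 1 ≤ Real.log (11 * B₁ ^ 2) := by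
  rw [Real.le_log_iff_exp_le (by positivity)]
  nlinarith [Real.exp_one_lt_d9]

lemma two_le_cartanExponent (hB₁ : 1 ≤ B₁) : 2 ≤ cartanExponent B₁ :=
  le_add_of_nonneg_right (div_nonneg (zero_le_one.trans (one_le_log_eleven_mul_sq hB₁))
    (log_one_add_inv_pos hB₁).le)

variable {Λ : ℝ}

/-- Since `log Λ` is bounded below in terms of `B₁` alone, the fixed quantity `log (11 * B₁ ^ 2)` is
absorbed into a multiple of it. -/
lemma log_le_cartanExponent_mul (hB₁ : 1 ≤ B₁) (hΛ : 1 + 1 / B₁ ≤ Λ) :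
    Real.log (11 * B₁ ^ 2 * Λ ^ 2) ≤ cartanExponent B₁ * Real.log Λ := by
  have h0 := log_one_add_inv_pos hB₁
  have h1 := one_le_log_eleven_mul_sq hB₁
  have hpos : 0 < 1 + 1 / B₁ := by positivity
  have h2 : Real.log (1 + 1 / B₁) ≤ Real.log Λ := Real.log_le_log hpos hΛ
  have hΛ0 : 0 < Λ := hpos.trans_le hΛ
  rw [Real.log_mul (by positivity) (by positivity), Real.log_pow, cartanExponent, add_mul]
  have h3 : Real.log (11 * B₁ ^ 2)
      ≤ Real.log (11 * B₁ ^ 2) / Real.log (1 + 1 / B₁) * Real.log Λ := by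
    rw [div_mul_eq_mul_div, le_div_iff₀ h0]
    exact mul_le_mul_of_nonneg_left h2 (by linarith)
  push_cast
  linarith

lemma one_le_cartanExponent_mul_log (hB₁ : 1 ≤ B₁) (hΛ : 1 + 1 / B₁ ≤ Λ) :
    1 ≤ cartanExponent B₁ * Real.log Λ := by
  refine le_trans ?_ (log_le_cartanExponent_mul hB₁ hΛ)
  have : 1 ≤ Λ := by linarith [show 0 < 1 / B₁ by positivity]
  refine (one_le_log_eleven_mul_sq hB₁).trans (Real.log_le_log (by positivity) ?_)
  exact le_mul_of_one_le_right (by positivity) (one_le_pow₀ this)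

lemma le_exp_cartanExponent_mul (hB₁ : 1 ≤ B₁) (hΛ : 1 + 1 / B₁ ≤ Λ) :
    11 * B₁ ^ 2 * Λ ^ 2 ≤ Real.exp (cartanExponent B₁ * Real.log Λ) := by
  have hΛ0 : 0 < Λ := lt_of_lt_of_le (by positivity) hΛ
  rw [← Real.log_le_iff_le_exp (by positivity)]
  exact log_le_cartanExponent_mul hB₁ hΛ

/-- Rests on `X ^ α ≤ 1 + X`; it trades the linear decay obtained for the stated power. -/
lemma exp_neg_mul_le_exp_neg_mul_rpow {c X α : ℝ} (hc : 0 ≤ c) (hX : 0 ≤ X) (hα0 : 0 ≤ α)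
    (hα1 : α ≤ 1) : Real.exp (-c * X) ≤ Real.exp c * Real.exp (-c * X ^ α) := by
  rw [← Real.exp_add, Real.exp_le_exp]
  have : X ^ α ≤ 1 + X := by
    rcases le_total X 1 with h | h
    · linarith [Real.rpow_le_one hX h hα0]
    · linarith [Real.rpow_le_self_of_one_le h hα1]
  nlinarith

lemma cartan_constants (hB₁ : 1 ≤ B₁) {B₂ M : ℝ} (hB₂ : 1 ≤ B₂) (hB₂Λ : B₂ ≤ Λ)
    (hΛ : 1 + 1 / B₁ ≤ Λ) (hM : 1 ≤ M) :
    1 ≤ cartanExponent B₁ * (M * Real.log Λ) ∧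
    (B₁ + B₁ * (2 * B₂) * B₁) ^ M ≤ Real.exp (cartanExponent B₁ * (M * Real.log Λ)) ∧
    (2 * B₂ + (1 + B₁ * (2 * B₂)) ^ 2) * (B₁ + B₁ * (2 * B₂) * B₁) ^ M
      ≤ Real.exp (2 * (cartanExponent B₁ * (M * Real.log Λ))) ∧
    Real.exp (-(cartanExponent B₁ * (M * Real.log Λ))) ≤ Λ ^ (-M) := by
  have hexp := le_exp_cartanExponent_mul hB₁ hΛ
  have hκ1 := one_le_cartanExponent_mul_log hB₁ hΛ
  have hA2 := two_le_cartanExponent hB₁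
  have hΛ1 : 1 ≤ Λ := by linarith
  have hlog : 0 ≤ M * Real.log Λ := mul_nonneg (by linarith) (Real.log_nonneg hΛ1)
  rw [mul_left_comm (cartanExponent B₁) M]
  generalize cartanExponent B₁ = A at *
  generalize hκ : A * Real.log Λ = κ at *
  have hB₁sq : B₁ ≤ B₁ ^ 2 := le_self_pow₀ hB₁ two_ne_zero
  have hB₂sq : B₂ ≤ B₂ ^ 2 := le_self_pow₀ hB₂ two_ne_zero
  have e0 : B₁ ^ 2 * B₂ ^ 2 ≤ B₁ ^ 2 * Λ ^ 2 := by gcongr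
  have e1 : B₁ ^ 2 * B₂ ≤ B₁ ^ 2 * B₂ ^ 2 := by gcongr
  have e2 : B₁ ≤ B₁ ^ 2 * B₂ ^ 2 :=
    hB₁sq.trans (le_mul_of_one_le_right (by positivity) (one_le_pow₀ hB₂))
  have e3 : B₂ ≤ B₁ ^ 2 * B₂ ^ 2 :=
    hB₂sq.trans (le_mul_of_one_le_left (by positivity) (one_le_pow₀ hB₁))
  have e4 : (1 + B₁ * (2 * B₂)) ^ 2 ≤ 9 * (B₁ ^ 2 * B₂ ^ 2) := by
    calc (1 + B₁ * (2 * B₂)) ^ 2 ≤ (3 * (B₁ * B₂)) ^ 2 := by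
          gcongr
          linarith [one_le_mul_of_one_le_of_one_le hB₁ hB₂]
      _ = _ := by ring
  have hpos : 0 ≤ B₁ ^ 2 * B₂ ^ 2 := by positivity
  have hβ : B₁ + B₁ * (2 * B₂) * B₁ ≤ Real.exp κ := by
    rw [show B₁ + B₁ * (2 * B₂) * B₁ = B₁ + 2 * (B₁ ^ 2 * B₂) by ring]
    linarith
  have hK1 : (B₁ + B₁ * (2 * B₂) * B₁) ^ M ≤ Real.exp (M * κ) := by
    refine (Real.rpow_le_rpow (by positivity) hβ (by linarith)).trans (le_of_eq ?_)
    rw [← Real.exp_mul, mul_comm]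
  -- The constant 11 is `2 + 9`, each term being compared with `B₁² * B₂²`.
  have hL : 2 * B₂ + (1 + B₁ * (2 * B₂)) ^ 2 ≤ Real.exp (M * κ) := by
    refine le_trans ?_ (Real.exp_le_exp.2 (le_mul_of_one_le_left (by linarith) hM))
    linarith
  refine ⟨one_le_mul_of_one_le_of_one_le hM hκ1, hK1, ?_, ?_⟩
  · rw [two_mul (M * κ), Real.exp_add]
    exact mul_le_mul hL hK1 (by positivity) (Real.exp_pos _).le
  · rw [Real.rpow_def_of_pos (by linarith), Real.exp_le_exp, ← hκ]
    nlinarith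

lemma exp_shifted_le {A L m : ℝ} (hA : 0 < A) (hm : 0 < m) :
    28 * Real.exp 2 * Real.exp (-(L - 2 * (A * m)) / (3 * (A * m)))
      ≤ 28 * Real.exp 3 * Real.exp (-(1 / (3 * A)) * (L / m)) := by
  have e : -(L - 2 * (A * m)) / (3 * (A * m)) = 2 / 3 + -(1 / (3 * A)) * (L / m) := by
    field_simp
    ring
  rw [e, Real.exp_add, mul_assoc, mul_assoc, ← mul_assoc (Real.exp 2), ← Real.exp_add]
  gcongr
  norm_num

end Constants

/-! ### Good points and assembly. -/

lemma isClosed_realCube (J : ℕ) (r : ℝ) : IsClosed (realCube J r) := by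
  have h : realCube J r = ⋂ i, {x : Fin J → ℝ | |x i| ≤ r} := by
    ext x
    simp [realCube]
  rw [h]
  exact isClosed_iInter fun i => isClosed_le (by fun_prop) continuous_const

lemma isClosed_setOf_le_invNorm {J N : ℕ} {T : (Fin J → ℝ) → Matrix (Fin N) (Fin N) ℂ} {δ : ℝ}
    (hT : ContinuousOn T (realCube J δ)) (a : ENNReal) :
    IsClosed {x ∈ realCube J δ | a ≤ invNorm (T x)} := by
  have h := hT.preimage_isClosed_of_isClosed (isClosed_realCube J δ)
    (isOpen_setOf_invNorm_lt a).isClosed_compl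
  refine (congrArg IsClosed ?_).mp h
  ext x
  simp

lemma exists_mem_closedBall_invNorm_lt {J N : ℕ} (hJ : 1 ≤ J)
    {T : (Fin J → ℝ) → Matrix (Fin N) (Fin N) ℂ} {δ B₁ B₂ B₃ r : ℝ} (hδ : 0 < δ) (hB₁ : 1 ≤ B₁)
    (hB₂ : 1 ≤ B₂)
    (hmes : MeasureTheory.volume {x ∈ realCube J δ | ENNReal.ofReal B₃ ≤ invNorm (T x)} ≤
      ENNReal.ofReal
        (δ ^ J / ((10 : ℝ) ^ (3 * J) * (J : ℝ) ^ J * (1 + B₁) ^ J * (1 + B₂) ^ J)))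
    {x₀ : Fin J → ℝ} (hx₀ : x₀ ∈ realCube J (δ / 2)) (hr : 0 < r) (hrδ : r ≤ δ / 2)
    (hrlow : δ ≤ r * (200 * B₁ * B₂)) :
    ∃ x₁ ∈ Metric.closedBall x₀ r, invNorm (T x₁) < ENNReal.ofReal B₃ := by
  by_contra hcon
  push Not at hcon
  have hsub : Metric.closedBall x₀ r ⊆ {x ∈ realCube J δ | ENNReal.ofReal B₃ ≤ invNorm (T x)} :=
    fun x hx => ⟨closedBall_subset_realCube hx₀ hrδ hx, hcon x hx⟩
  have h := (MeasureTheory.measure_mono hsub).trans hmes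
  rw [Real.volume_pi_closedBall _ hr.le, Fintype.card_fin,
    ENNReal.ofReal_le_ofReal_iff (by positivity), pow_mul, ← mul_pow, ← mul_pow, ← mul_pow,
    ← div_pow] at h
  have hJ' : (1 : ℝ) ≤ J := by exact_mod_cast hJ
  -- After `J`-th roots, the side `2r ≥ δ / (100 * B₁ * B₂)` would be at most `δ / (1000 * J * (1 +
  -- B₁) * (1 + B₂))`.
  have h2 := (pow_le_pow_iff_left₀ (by positivity) (by positivity) (by omega)).1 h
  rw [le_div_iff₀ (by positivity)] at h2
  have h3 : 2 * r * (1000 * (B₁ * B₂)) ≤ 2 * r * (10 ^ 3 * J * (1 + B₁) * (1 + B₂)) := by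
    refine mul_le_mul_of_nonneg_left ?_ (by positivity)
    calc 1000 * (B₁ * B₂) ≤ 1000 * ((1 + B₁) * (1 + B₂)) := by gcongr <;> linarith
      _ ≤ 1000 * ((1 + B₁) * (1 + B₂)) * J := le_mul_of_one_le_right (by positivity) hJ'
      _ = _ := by ring
  have : 0 < r * (B₁ * B₂) := by positivity
  nlinarith

lemma invNorm_eq_zero_of_isEmpty {n : Type*} [Fintype n] [DecidableEq n] [IsEmpty n]
    (A : Matrix n n ℂ) : invNorm A = 0 := by
  rw [invNorm, if_pos (isUnit_of_subsingleton A), Subsingleton.elim A⁻¹ 0, norm_zero,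
    ENNReal.ofReal_zero]

lemma one_div_le_norm_inv {n : Type*} [Fintype n] [DecidableEq n] [Nonempty n] {A : Matrix n n ℂ}
    (hA : IsUnit A) {b : ℝ} (hb : 0 < b) (hAb : ‖A‖ ≤ b) : 1 / b ≤ ‖A⁻¹‖ := by
  rw [div_le_iff₀ hb]
  calc 1 = ‖(1 : Matrix n n ℂ)‖ := norm_one.symm
    _ = ‖A⁻¹ * A‖ := by rw [Matrix.nonsing_inv_mul _ ((Matrix.isUnit_iff_isUnit_det _).1 hA)]
    _ ≤ ‖A⁻¹‖ * ‖A‖ := norm_mul_le _ _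
    _ ≤ ‖A⁻¹‖ * b := by gcongr

theorem lemma3p2 (J : ℕ) (hJ : 1 ≤ J) (B₁ : ℝ) (hB₁ : 1 ≤ B₁) :
    ∃ C c : ℝ, 0 < C ∧ 0 < c ∧
      ∀ (N : ℕ) (T : (Fin J → ℝ) → Matrix (Fin N) (Fin N) ℂ) (δ B₂ B₃ M ε : ℝ),
        0 < δ → 1 ≤ B₂ → 1 ≤ M →
        (∀ x ∈ realCube J δ, (T x).IsHermitian) →
        AnalyticOn ℝ T (realCube J δ) →
        HasBoundedHolomorphicExtension T δ B₁ →
        (∀ x ∈ realCube J δ, ∃ V : Finset (Fin N), (V.card : ℝ) ≤ M ∧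
          invNorm (compressOff (T x) V) ≤ ENNReal.ofReal B₂) →
        MeasureTheory.volume {x ∈ realCube J δ | ENNReal.ofReal B₃ ≤ invNorm (T x)} ≤
          ENNReal.ofReal
            (δ ^ J / ((10 : ℝ) ^ (3 * J) * (J : ℝ) ^ J * (1 + B₁) ^ J * (1 + B₂) ^ J)) →
        0 < ε → ε ≤ (1 + B₁ + B₂) ^ (-(10 * M)) →
        MeasureTheory.volume {x ∈ realCube J (δ / 2) | ENNReal.ofReal ε⁻¹ ≤ invNorm (T x)} ≤
          ENNReal.ofReal (C * δ ^ J *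
            Real.exp (-c * (Real.log ε⁻¹ / (M * Real.log (B₂ + B₃))) ^ (1 / (J : ℝ)))) := by
  set A := cartanExponent B₁ with hAdef
  have hA2 : 2 ≤ A := two_le_cartanExponent hB₁
  have hc : 0 < 1 / (3 * A) := by positivity
  have hJ' : (1 : ℝ) ≤ J := by exact_mod_cast hJ
  refine ⟨28 * Real.exp 3 * (J * 2 ^ J) * Real.exp (1 / (3 * A)), 1 / (3 * A), by positivity, hc,
    ?_⟩
  intro N T δ B₂ B₃ M ε hδ hB₂ hM hherm hT hext hcompr hmes hε hεle
  -- Empty matrices have inverse of norm 0, so the bad set is empty; the lower bound on `B₃` below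
  -- needs `N > 0`.
  rcases Nat.eq_zero_or_pos N with rfl | hN
  · have hempty : {x ∈ realCube J (δ / 2) | ENNReal.ofReal ε⁻¹ ≤ invNorm (T x)} = ∅ := by
      ext x
      simp [invNorm_eq_zero_of_isEmpty, hε]
    rw [hempty, MeasureTheory.measure_empty]
    exact zero_le
  have : Nonempty (Fin N) := ⟨⟨0, hN⟩⟩
  obtain ⟨F, hF, hFT, hFB⟩ := hext
  have hBB : 1 ≤ B₁ * B₂ := one_le_mul_of_one_le_of_one_le hB₁ hB₂
  -- Puts `δ / r = 2n` between `72 * B₁ * B₂` (stability of the compression) and `200 * B₁ * B₂`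
  -- (existence of a good point).
  set n := ⌈36 * (B₁ * B₂)⌉₊ with hn
  have hn1 : 36 * (B₁ * B₂) ≤ n := Nat.le_ceil _
  have hn2 : (n : ℝ) < 36 * (B₁ * B₂) + 1 := Nat.ceil_lt_add_one (by positivity)
  have hn0 : (0 : ℝ) < n := by linarith
  set r := δ / (2 * n) with hrdef
  have hr : 0 < r := by positivity
  have hrn : δ = r * (2 * n) := by rw [hrdef]; field_simp
  have hr1 : r * (72 * B₁ * B₂) ≤ δ := by
    rw [hrn]
    exact mul_le_mul_of_nonneg_left (by linarith) hr.le
  have hr2 : δ ≤ r * (200 * B₁ * B₂) := by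
    rw [hrn]
    exact mul_le_mul_of_nonneg_left (by linarith) hr.le
  have hrδ : r ≤ δ / 2 := by
    rw [hrn]
    linarith [le_mul_of_one_le_right hr.le (by linarith : (1 : ℝ) ≤ n)]
  have hgood := fun {x₀ : Fin J → ℝ} (hx₀ : x₀ ∈ realCube J (δ / 2)) =>
    exists_mem_closedBall_invNorm_lt hJ hδ hB₁ hB₂ hmes hx₀ hr hrδ hr2
  have hFT' : ∀ x ∈ realCube J δ, F (toComplexVec x) = T x := hFT
  have hTB : ∀ x ∈ realCube J δ, ‖T x‖ ≤ B₁ := fun x hx => by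
    rw [← hFT' x hx]
    refine hFB _ fun i => ?_
    simpa [toComplexVec] using ⟨hx i, hδ.le⟩
  have hhalf : realCube J (δ / 2) ⊆ realCube J δ := fun x hx i => (hx i).trans (by linarith)
  -- At a good point the inverse has norm below `B₃` but at least `1 / B₁`, so `Λ` stays away from
  -- 1.
  have hB₃ : 1 / B₁ ≤ B₃ := by
    have h0 : (0 : Fin J → ℝ) ∈ realCube J (δ / 2) := fun i => by simpa using (half_pos hδ).le
    obtain ⟨x₁, hx₁, hlt⟩ := hgood h0
    obtain ⟨hu, hle⟩ := isUnit_of_invNorm_lt_ofReal hlt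
    exact (one_div_le_norm_inv hu (by linarith)
      (hTB _ (closedBall_subset_realCube h0 hrδ hx₁))).trans hle.le
  set Λ := B₂ + B₃ with hΛdef
  have hΛ : 1 + 1 / B₁ ≤ Λ := add_le_add hB₂ hB₃
  have hB₁inv : 0 < 1 / B₁ := by positivity
  have hΛ1 : 1 < Λ := by linarith
  have hB₂Λ : B₂ ≤ Λ := by linarith
  have hlogΛ : 0 < Real.log Λ := Real.log_pos hΛ1
  obtain ⟨hK, hK1, hK2, hK3⟩ := cartan_constants hB₁ hB₂ hB₂Λ hΛ hM
  rw [← hAdef] at hK hK1 hK2 hK3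
  set K := A * (M * Real.log Λ) with hKdef
  set X := Real.log ε⁻¹ / (M * Real.log Λ) with hXdef
  -- The smallness of `ε` enters only here, as `ε ≤ 1`.
  have hX : 0 ≤ X := by
    refine div_nonneg (Real.log_nonneg ?_) (by positivity)
    rw [one_le_inv₀ hε]
    exact hεle.trans (Real.rpow_le_one_of_one_le_of_nonpos (by linarith) (by linarith))
  set q := 28 * Real.exp 2 * Real.exp (-(Real.log ε⁻¹ - 2 * K) / (3 * K)) with hqdef
  have hq : q ≤ 28 * Real.exp 3 * Real.exp (-(1 / (3 * A)) * X) :=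
    exp_shifted_le (by linarith) (by positivity)
  set S := {x ∈ realCube J δ | ENNReal.ofReal ε⁻¹ ≤ invNorm (T x)} with hSdef
  have hSclosed : IsClosed S := isClosed_setOf_le_invNorm hT.continuousOn _
  obtain ⟨c, hcmem, hcover⟩ :=
    realCube_subset_iUnion_closedBall (J := J) hδ (n := n) (Nat.cast_pos.1 hn0)
  have hlocal : ∀ k, MeasureTheory.volume (S ∩ Metric.closedBall (c k) r)
      ≤ ENNReal.ofReal ((2 * r) ^ J * q * (J * 2 ^ J)) := by
    intro k
    obtain ⟨x₁, hx₁, hlt⟩ := hgood (hcmem k)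
    obtain ⟨hu, hle⟩ := isUnit_of_invNorm_lt_ofReal hlt
    have hx₁δ := closedBall_subset_realCube (hcmem k) hrδ hx₁
    obtain ⟨V, hV, hVinv⟩ := hcompr (c k) (hhalf (hcmem k))
    rw [← hFT' _ (hhalf (hcmem k))] at hVinv
    rw [← hFT' _ hx₁δ] at hu hle
    refine volume_large_invNorm_inter_closedBall_le hJ hδ hB₁ hB₂ hF hFB (hcmem k) hV hVinv hr hr1
      hx₁ hu (hle.le.trans (by linarith : B₃ ≤ Λ)) hΛ1.le hK hK1 hK2 hK3 hε
      (hSclosed.inter Metric.isClosed_closedBall).measurableSet Set.inter_subset_right ?_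
    rintro x ⟨⟨hx, hbad⟩, -⟩
    rw [hFT' x hx]
    exact ⟨hherm x hx, hbad⟩
  calc MeasureTheory.volume {x ∈ realCube J (δ / 2) | ENNReal.ofReal ε⁻¹ ≤ invNorm (T x)}
      ≤ MeasureTheory.volume (⋃ k, S ∩ Metric.closedBall (c k) r) := by
        refine MeasureTheory.measure_mono fun x hx => ?_
        rw [← Set.inter_iUnion]
        exact ⟨⟨hhalf hx.1, hx.2⟩, hcover hx.1⟩
    _ ≤ ∑ k : Fin J → Fin n, ENNReal.ofReal ((2 * r) ^ J * q * (J * 2 ^ J)) :=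
        (MeasureTheory.measure_iUnion_fintype_le _ _).trans (Finset.sum_le_sum fun k _ => hlocal k)
    -- The `n ^ J` cells contribute `(2r) ^ J` each, and `2 * r * n = δ`, so no dependence on `B₂`
    -- survives in the prefactor.
    _ = ENNReal.ofReal (δ ^ J * q * (J * 2 ^ J)) := by
        rw [Finset.sum_const, Finset.card_univ, Fintype.card_fun, Fintype.card_fin,
          Fintype.card_fin, nsmul_eq_mul, ← ENNReal.ofReal_natCast,
          ← ENNReal.ofReal_mul (by positivity), hrn]
        congr 1
        push_cast
        rw [mul_pow, mul_pow, mul_pow]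
        ring
    _ ≤ _ := by
        apply ENNReal.ofReal_le_ofReal
        have hfin := exp_neg_mul_le_exp_neg_mul_rpow hc.le hX (α := 1 / (J : ℝ)) (by positivity)
          ((div_le_one (by linarith)).2 hJ')
        calc δ ^ J * q * (J * 2 ^ J)
            ≤ δ ^ J * (28 * Real.exp 3 * (Real.exp (1 / (3 * A))
              * Real.exp (-(1 / (3 * A)) * X ^ (1 / (J : ℝ))))) * (J * 2 ^ J) := by
              gcongr
              refine hq.trans ?_
              gcongr
          _ = _ := by ring
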